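/- Let $k$ be an algebraically closed field of characteristic $0$. For $\lambda\in k$ with $\lambda^3\neq 1$ let $E=\{(x:y:z)\in\mathbb{P}^2 : x^3+y^3+z^3=3\lambda xyz\}$ be the Hesse cubic, an elliptic curve with zero element $o_E=(1:-1:0)$, whose addition is given, for $p=(a:b:c)$ and $q=(\alpha:\beta:\gamma)$, by $$p+q=(ac\beta^2-b^2\alpha\gamma:bc\alpha^2-a^2\beta\gamma:ab\gamma^2-c^2\alpha\beta)$$ or, where this is not defined, by $$p+q=(ab\alpha^2-c^2\beta\gamma:ac\gamma^2-b^2\alpha\beta:bc\beta^2-a^2\alpha\gamma).$$ Write $E[n]=\{p\in E: np=o_E\}$ and $$j(E)=\frac{27\lambda^3(\lambda^3+8)^3}{(\lambda^3-1)^3}.$$ For an automorphism $\tau$ of $E$ fixing $o_E$ and an integer $i \ge 0$ put $$U_{\tau^i}=\{p\in E: p-\tau^i(p)\in E[3]\},\qquad E_{\tau^i}=\{p\in E:\tau^i(p)=p\}.$$ Let $\varepsilon$ be a primitive third root of unity in $k$. 1. Suppose $j(E)\neq 0,12^3$, and let $\tau_1(a:b:c)=(b:a:c)$. Then $U_{\tau_1^0}=E$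 and $U_{\tau_1}=E[6]$. 2. Suppose $\lambda=0$, let $\tau_2(a:b:c)=(b:a:c\varepsilon)$, let $\eta$ be a primitive $9$th root of unity, and let $q=(\eta^8:\eta^4:1)\in E$. Then $$U_{\tau_2^i}=\begin{cases}E & \text{if } i=0,\\ E[3] & \text{if } i=1,5,\\ E[3]\sqcup\{\tau_2^l(q)+r : 0\le l\le 5,\ r\in E_{\tau_2^2}\} & \text{if } i=2,4,\\ E[6] & \text{if } i=3,\end{cases}$$ where the union is disjoint and the set $\{\tau_2^l(q)+r\}$ has exactly $18$ elements. 3. Suppose $\lambda=1+\sqrt3$ for a square root $\sqrt3$ of $3$ in $k$, and let $\tau_3(a:b:c)=(a\varepsilon^2+b\varepsilon+c:a\varepsilon+b\varepsilon^2+c:a+b+c)$. Then $$U_{\tau_3^i}=\begin{cases}E & \text{if } i=0,\\ \langle(1:1:\lambda)\rangle\oplus E[3] & \text{if } i=1,3,\\ E[6] & \text{if } i=2,\end{cases}$$ where $\langle(1:1:\lambda)\rangle$ is the subgroup generated by $(1:1:\lambda)$ and the sum is an internal direct sum. -/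

import Mathlib

/-- The Hesse cubic form `x³ + y³ + z³ - 3 λ x y z`, evaluated at a vector. -/
def hesseForm {k : Type*} [Field k] (lam : k) (v : Fin 3 → k) : k :=
  v 0 ^ 3 + v 1 ^ 3 + v 2 ^ 3 - 3 * lam * (v 0 * v 1 * v 2)

/-- The Hesse cubic `E = V(x³ + y³ + z³ - 3 λ x y z) ⊆ ℙ²` (the set of its `k`-points), for
`λ³ ≠ 1`. The vanishing of the form does not depend on the representative, see
`HesseCurve.form_rep_mk`. -/
def HesseCurve {k : Type*} [Field k] (lam : k) (_h : lam ^ 3 ≠ 1) : Type _ :=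
  {P : Projectivization k (Fin 3 → k) // hesseForm lam P.rep = 0}

/-- The `j`-invariant of the Hesse cubic. -/
def hesseJ {k : Type*} [Field k] (lam : k) : k :=
  27 * lam ^ 3 * (lam ^ 3 + 8) ^ 3 / (lam ^ 3 - 1) ^ 3

/-- The first addition formula. -/
def hesseAddFst {k : Type*} [Field k] (p q : Fin 3 → k) : Fin 3 → k :=
  ![p 0 * p 2 * q 1 ^ 2 - p 1 ^ 2 * q 0 * q 2,
    p 1 * p 2 * q 0 ^ 2 - p 0 ^ 2 * q 1 * q 2,
    p 0 * p 1 * q 2 ^ 2 - p 2 ^ 2 * q 0 * q 1]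

/-- The second addition formula. -/
def hesseAddSnd {k : Type*} [Field k] (p q : Fin 3 → k) : Fin 3 → k :=
  ![p 0 * p 1 * q 0 ^ 2 - p 2 ^ 2 * q 1 * q 2,
    p 0 * p 2 * q 2 ^ 2 - p 1 ^ 2 * q 0 * q 1,
    p 1 * p 2 * q 1 ^ 2 - p 0 ^ 2 * q 0 * q 2]

namespace HesseCurve

theorem form_smul {k : Type*} [Field k] (lam t : k) (v : Fin 3 → k) :
    hesseForm lam (t • v) = t ^ 3 * hesseForm lam v := by
  simp [hesseForm]; ring

theorem form_rep_mk {k : Type*} [Field k] (lam : k) (v : Fin 3 → k) (hv : v ≠ 0) :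
    hesseForm lam (Projectivization.mk k v hv).rep = 0 ↔ hesseForm lam v = 0 := by
  obtain ⟨a, ha⟩ := Projectivization.exists_smul_eq_mk_rep k v hv
  rw [← ha, Units.smul_def, form_smul]
  simp

/-- The point of the Hesse cubic with the given homogeneous coordinates. -/
def mk {k : Type*} [Field k] {lam : k} {h : lam ^ 3 ≠ 1} (v : Fin 3 → k) (hv : v ≠ 0)
    (hF : hesseForm lam v = 0) : HesseCurve lam h :=
  ⟨Projectivization.mk k v hv, (form_rep_mk lam v hv).2 hF⟩

theorem mk_rep {k : Type*} [Field k] {lam : k} {h : lam ^ 3 ≠ 1} (P : HesseCurve lam h) :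
    mk (h := h) P.1.rep P.1.rep_nonzero P.2 = P :=
  Subtype.ext (Projectivization.mk_rep P.1)

theorem mk_eq_mk {k : Type*} [Field k] {lam : k} {h : lam ^ 3 ≠ 1} {v w : Fin 3 → k}
    {hv : v ≠ 0} {hw : w ≠ 0} {hFv : hesseForm lam v = 0} {hFw : hesseForm lam w = 0} (t : k)
    (ht : t • w = v) : mk (h := h) v hv hFv = mk w hw hFw :=
  Subtype.ext ((Projectivization.mk_eq_mk_iff' k v w hv hw).2 ⟨t, ht⟩)

theorem form_addFst {k : Type*} [Field k] {lam : k} {p q : Fin 3 → k}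
    (hp : hesseForm lam p = 0) (hq : hesseForm lam q = 0) :
    hesseForm lam (hesseAddFst p q) = 0 := by
  simp only [hesseForm, hesseAddFst, Matrix.cons_val] at *
  grind

theorem form_addSnd {k : Type*} [Field k] {lam : k} {p q : Fin 3 → k}
    (hp : hesseForm lam p = 0) (hq : hesseForm lam q = 0) :
    hesseForm lam (hesseAddSnd p q) = 0 := by
  simp only [hesseForm, hesseAddSnd, Matrix.cons_val] at *
  grind

theorem vec_ne_zero {k : Type*} [Field k] {v : Fin 3 → k} (hv : v ≠ 0) :
    ¬(v 0 = 0 ∧ v 1 = 0 ∧ v 2 = 0) := by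
  rintro ⟨h0, h1, h2⟩
  apply hv
  ext i
  fin_cases i <;> simp [h0, h1, h2]

/-- At least one of the two addition formulas yields a point of the projective plane. -/
theorem addSnd_ne_zero {k : Type*} [Field k] [CharZero k] {lam : k} (h : lam ^ 3 ≠ 1)
    {p q : Fin 3 → k} (hp0 : p ≠ 0) (hq0 : q ≠ 0) (hp : hesseForm lam p = 0)
    (hq : hesseForm lam q = 0) (h1 : hesseAddFst p q = 0) : hesseAddSnd p q ≠ 0 := by
  intro h2
  have hp0 := vec_ne_zero hp0
  have hq0 := vec_ne_zero hq0
  have e0 := congrFun h1 0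
  have e1 := congrFun h1 1
  have e2 := congrFun h1 2
  have f0 := congrFun h2 0
  have f1 := congrFun h2 1
  have f2 := congrFun h2 2
  simp only [hesseForm, hesseAddFst, hesseAddSnd, Matrix.cons_val, Pi.zero_apply] at *
  generalize p 0 = a at *
  generalize p 1 = b at *
  generalize p 2 = c at *
  generalize q 0 = x at *
  generalize q 1 = y at *
  generalize q 2 = z at *
  clear h1 h2
  have hab : a ≠ 0 ∨ b ≠ 0 := by
    by_contra! H
    obtain ⟨rfl, rfl⟩ := H
    have : c ^ 3 = 0 := by linear_combination hp
    exact hp0 ⟨rfl, rfl, pow_eq_zero_iff (by norm_num) |>.1 this⟩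
  have hbc : b ≠ 0 ∨ c ≠ 0 := by
    by_contra! H
    obtain ⟨rfl, rfl⟩ := H
    have : a ^ 3 = 0 := by linear_combination hp
    exact hp0 ⟨pow_eq_zero_iff (by norm_num) |>.1 this, rfl, rfl⟩
  have hac : a ≠ 0 ∨ c ≠ 0 := by
    by_contra! H
    obtain ⟨rfl, rfl⟩ := H
    have : b ^ 3 = 0 := by linear_combination hp
    exact hp0 ⟨rfl, pow_eq_zero_iff (by norm_num) |>.1 this, rfl⟩
  have hxy : x ≠ 0 ∨ y ≠ 0 := by
    by_contra! H
    obtain ⟨rfl, rfl⟩ := H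
    have : z ^ 3 = 0 := by linear_combination hq
    exact hq0 ⟨rfl, rfl, pow_eq_zero_iff (by norm_num) |>.1 this⟩
  have hyz : y ≠ 0 ∨ z ≠ 0 := by
    by_contra! H
    obtain ⟨rfl, rfl⟩ := H
    have : x ^ 3 = 0 := by linear_combination hq
    exact hq0 ⟨pow_eq_zero_iff (by norm_num) |>.1 this, rfl, rfl⟩
  have hxz : x ≠ 0 ∨ z ≠ 0 := by
    by_contra! H
    obtain ⟨rfl, rfl⟩ := H
    have : y ^ 3 = 0 := by linear_combination hq
    exact hq0 ⟨rfl, pow_eq_zero_iff (by norm_num) |>.1 this, rfl⟩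
  by_cases ha : a = 0
  · subst ha
    simp_all
  by_cases hb : b = 0
  · subst hb
    simp_all
  by_cases hc : c = 0
  · subst hc
    simp_all
  by_cases hx : x = 0
  · subst hx
    simp_all
  by_cases hy : y = 0
  · subst hy
    simp_all
  by_cases hz : z = 0
  · subst hz
    simp_all
  have k1 : a ^ 3 = b ^ 3 := by
    have : (x * z) * (a ^ 3 - b ^ 3) = 0 := by linear_combination -a * f2 + b * e0
    simpa [hx, hz, sub_eq_zero] using this
  have k2 : b ^ 3 = c ^ 3 := by
    have : (x * y) * (b ^ 3 - c ^ 3) = 0 := by linear_combination -b * f1 + c * e2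
    simpa [hx, hy, sub_eq_zero] using this
  apply h
  have k3 : a ^ 3 = lam * (a * b * c) := by
    have : (3 : k) * (a ^ 3 - lam * (a * b * c)) = 0 := by
      linear_combination hp + 2 * k1 + k2
    simpa [sub_eq_zero] using this
  have k4 : (a ^ 9) * (lam ^ 3 - 1) = 0 := by
    have e : (lam * (a * b * c)) ^ 3 = lam ^ 3 * a ^ 3 * b ^ 3 * c ^ 3 := by ring
    rw [← k3, ← k2, ← k1] at e
    linear_combination -e
  simpa [ha, sub_eq_zero] using k4

open Classical in
/-- The addition of the Hesse cubic with zero element `(1 : -1 : 0)`: the first addition formula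
where it gives a point of the projective plane, the second one elsewhere. -/
noncomputable def add {k : Type*} [Field k] [CharZero k] {lam : k} {h : lam ^ 3 ≠ 1}
    (P Q : HesseCurve lam h) : HesseCurve lam h :=
  if hv : hesseAddFst P.1.rep Q.1.rep = 0 then
    mk (hesseAddSnd P.1.rep Q.1.rep)
      (addSnd_ne_zero h P.1.rep_nonzero Q.1.rep_nonzero P.2 Q.2 hv) (form_addSnd P.2 Q.2)
  else mk (hesseAddFst P.1.rep Q.1.rep) hv (form_addFst P.2 Q.2)

theorem origin_ne_zero {k : Type*} [Field k] : (![1, -1, 0] : Fin 3 → k) ≠ 0 := by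
  intro h
  simpa using congrFun h 0

/-- The zero element `o_E = (1 : -1 : 0)`. -/
def origin {k : Type*} [Field k] {lam : k} {h : lam ^ 3 ≠ 1} : HesseCurve lam h :=
  mk ![1, -1, 0] origin_ne_zero (by simp [hesseForm]; ring)

theorem swap_ne_zero {k : Type*} [Field k] {v : Fin 3 → k} (hv : v ≠ 0) :
    ![v 1, v 0, v 2] ≠ 0 := by
  intro h
  have h0 := congrFun h 0
  have h1 := congrFun h 1
  have h2 := congrFun h 2
  simp at h0 h1 h2
  exact vec_ne_zero hv ⟨h1, h0, h2⟩

theorem form_swap {k : Type*} [Field k] {lam : k} {v : Fin 3 → k} (hv : hesseForm lam v = 0) :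
    hesseForm lam ![v 1, v 0, v 2] = 0 := by
  simp only [hesseForm, Matrix.cons_val] at *
  linear_combination hv

/-- The automorphism `τ₁(a : b : c) = (b : a : c)`. -/
noncomputable def tau1 {k : Type*} [Field k] {lam : k} {h : lam ^ 3 ≠ 1} (P : HesseCurve lam h) :
    HesseCurve lam h :=
  mk ![P.1.rep 1, P.1.rep 0, P.1.rep 2] (swap_ne_zero P.1.rep_nonzero) (form_swap P.2)

theorem tau1_mk {k : Type*} [Field k] {lam : k} {h : lam ^ 3 ≠ 1} (v : Fin 3 → k) (hv : v ≠ 0)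
    (hF : hesseForm lam v = 0) :
    tau1 (mk v hv hF : HesseCurve lam h) = mk ![v 1, v 0, v 2] (swap_ne_zero hv) (form_swap hF) := by
  obtain ⟨a, ha⟩ := Projectivization.exists_smul_eq_mk_rep k v hv
  refine mk_eq_mk (a : k) ?_
  change _ = ![(Projectivization.mk k v hv).rep 1, (Projectivization.mk k v hv).rep 0,
    (Projectivization.mk k v hv).rep 2]
  rw [← ha]
  ext i
  fin_cases i <;> simp [Units.smul_def]

theorem addFst_smul {k : Type*} [Field k] (s t : k) (p q : Fin 3 → k) :
    hesseAddFst (s • p) (t • q) = (s ^ 2 * t ^ 2) • hesseAddFst p q := by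
  ext i
  fin_cases i <;> simp [hesseAddFst] <;> ring

theorem addSnd_smul {k : Type*} [Field k] (s t : k) (p q : Fin 3 → k) :
    hesseAddSnd (s • p) (t • q) = (s ^ 2 * t ^ 2) • hesseAddSnd p q := by
  ext i
  fin_cases i <;> simp [hesseAddSnd] <;> ring

/-- The sum is computed by the first formula on arbitrary representatives, if it applies. -/
theorem add_mk_fst {k : Type*} [Field k] [CharZero k] {lam : k} {h : lam ^ 3 ≠ 1} {p q : Fin 3 → k}
    (hp : p ≠ 0) (hq : q ≠ 0) (hFp : hesseForm lam p = 0) (hFq : hesseForm lam q = 0)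
    (hv : hesseAddFst p q ≠ 0) :
    add (mk p hp hFp : HesseCurve lam h) (mk q hq hFq) =
      mk (hesseAddFst p q) hv (form_addFst hFp hFq) := by
  obtain ⟨a, ha⟩ := Projectivization.exists_smul_eq_mk_rep k p hp
  obtain ⟨b, hb⟩ := Projectivization.exists_smul_eq_mk_rep k q hq
  have e : hesseAddFst (Projectivization.mk k p hp).rep (Projectivization.mk k q hq).rep =
      ((a : k) ^ 2 * (b : k) ^ 2) • hesseAddFst p q := by
    rw [← ha, ← hb, Units.smul_def, Units.smul_def, addFst_smul]
  have hne : hesseAddFst (Projectivization.mk k p hp).rep (Projectivization.mk k q hq).rep ≠ 0 := by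
    rw [e]
    exact smul_ne_zero (by simp) hv
  unfold add
  rw [dif_neg (show ¬ hesseAddFst (mk p hp hFp : HesseCurve lam h).1.rep
    (mk q hq hFq : HesseCurve lam h).1.rep = 0 from hne)]
  exact mk_eq_mk _ e.symm

/-- The sum is computed by the second formula where the first one does not apply. -/
theorem add_mk_snd {k : Type*} [Field k] [CharZero k] {lam : k} {h : lam ^ 3 ≠ 1} {p q : Fin 3 → k}
    (hp : p ≠ 0) (hq : q ≠ 0) (hFp : hesseForm lam p = 0) (hFq : hesseForm lam q = 0)
    (hv : hesseAddFst p q = 0) :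
    add (mk p hp hFp : HesseCurve lam h) (mk q hq hFq) =
      mk (hesseAddSnd p q) (addSnd_ne_zero h hp hq hFp hFq hv) (form_addSnd hFp hFq) := by
  obtain ⟨a, ha⟩ := Projectivization.exists_smul_eq_mk_rep k p hp
  obtain ⟨b, hb⟩ := Projectivization.exists_smul_eq_mk_rep k q hq
  have e : hesseAddSnd (Projectivization.mk k p hp).rep (Projectivization.mk k q hq).rep =
      ((a : k) ^ 2 * (b : k) ^ 2) • hesseAddSnd p q := by
    rw [← ha, ← hb, Units.smul_def, Units.smul_def, addSnd_smul]
  have hne : hesseAddFst (Projectivization.mk k p hp).rep (Projectivization.mk k q hq).rep = 0 := by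
    rw [← ha, ← hb, Units.smul_def, Units.smul_def, addFst_smul, hv, smul_zero]
  unfold add
  rw [dif_pos (show hesseAddFst (mk p hp hFp : HesseCurve lam h).1.rep
    (mk q hq hFq : HesseCurve lam h).1.rep = 0 from hne)]
  exact mk_eq_mk _ e.symm

/-- The constant `m = 4(λ³ - 1)/3`. -/
def weierM {k : Type*} [Field k] (lam : k) : k := 4 * (lam ^ 3 - 1) / 3

/-- The Weierstrass equation `Y² = X³ - 3λ² X² + 2λm X - m²/3` with `m = 4(λ³ - 1)/3`, into which
the coordinates `X = m z`, `Y = m (x - y)`, `Z = x + y + λ z` take the Hesse cubic. It is only used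
to prove the group axioms. -/
def weier {k : Type*} [Field k] (lam : k) : WeierstrassCurve.Affine k where
  a₁ := 0
  a₂ := -3 * lam ^ 2
  a₃ := 0
  a₄ := 2 * lam * weierM lam
  a₆ := -weierM lam ^ 2 / 3

theorem weierM_ne_zero {k : Type*} [Field k] [CharZero k] {lam : k} (h : lam ^ 3 ≠ 1) :
    weierM lam ≠ 0 := by
  have := sub_ne_zero.2 h
  simp [weierM, this]

theorem weier_disc_eq {k : Type*} [Field k] [CharZero k] (lam : k) :
    WeierstrassCurve.Δ (weier lam) = 4096 / 27 * (lam ^ 3 - 1) ^ 3 := by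
  simp only [WeierstrassCurve.Δ, WeierstrassCurve.b₂, WeierstrassCurve.b₄, WeierstrassCurve.b₆,
    WeierstrassCurve.b₈, weier, weierM]
  field_simp
  ring

theorem weier_disc {k : Type*} [Field k] [CharZero k] {lam : k} (h : lam ^ 3 ≠ 1) :
    WeierstrassCurve.Δ (weier lam) ≠ 0 := by
  rw [weier_disc_eq]
  have := sub_ne_zero.2 h
  simp [this]

/-- The formula for the `j`-invariant agrees with `j = c₄³ / Δ` of the Weierstrass equation. -/
theorem hesseJ_eq {k : Type*} [Field k] [CharZero k] {lam : k} (h : lam ^ 3 ≠ 1) :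
    hesseJ lam = WeierstrassCurve.c₄ (weier lam) ^ 3 / WeierstrassCurve.Δ (weier lam) := by
  have h1 := sub_ne_zero.2 h
  rw [eq_div_iff (weier_disc h), weier_disc_eq]
  simp only [hesseJ, WeierstrassCurve.c₄, WeierstrassCurve.b₂, WeierstrassCurve.b₄, weier, weierM]
  field_simp
  ring

/-- The linear form `x + y + λ z`, whose zero set is the tangent line at `(1 : -1 : 0)`. -/
def tangentForm {k : Type*} [Field k] (lam : k) (v : Fin 3 → k) : k := v 0 + v 1 + lam * v 2

theorem weier_nonsingular {k : Type*} [Field k] [CharZero k] {lam : k} (h : lam ^ 3 ≠ 1)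
    {v : Fin 3 → k} (hF : hesseForm lam v = 0) (hZ : tangentForm lam v ≠ 0) :
    (weier lam).Nonsingular (weierM lam * v 2 / tangentForm lam v)
      (weierM lam * (v 0 - v 1) / tangentForm lam v) := by
  rw [← WeierstrassCurve.Affine.equation_iff_nonsingular_of_Δ_ne_zero (weier_disc h),
    WeierstrassCurve.Affine.equation_iff]
  simp only [weier]
  have hm : 3 * weierM lam = 4 * (lam ^ 3 - 1) := by
    simp only [weierM]
    field_simp
  generalize hz : tangentForm lam v = Z at *
  generalize weierM lam = m at *
  simp only [hesseForm, tangentForm] at *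
  generalize v 0 = a at *
  generalize v 1 = b at *
  generalize v 2 = c at *
  obtain rfl : a = Z - b - lam * c := by linear_combination hz
  field_simp
  clear hz h
  grind

open Classical in
/-- The map from the Hesse cubic to the Weierstrass cubic. -/
noncomputable def toWeier {k : Type*} [Field k] [CharZero k] {lam : k} {h : lam ^ 3 ≠ 1}
    (P : HesseCurve lam h) : (weier lam).Point :=
  if hZ : tangentForm lam P.1.rep = 0 then 0
  else .some _ _ (weier_nonsingular h P.2 hZ)

theorem tangentForm_smul {k : Type*} [Field k] (lam t : k) (v : Fin 3 → k) :
    tangentForm lam (t • v) = t * tangentForm lam v := by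
  simp [tangentForm]; ring

theorem toWeier_mk_zero {k : Type*} [Field k] [CharZero k] {lam : k} {h : lam ^ 3 ≠ 1}
    {v : Fin 3 → k} (hv : v ≠ 0) (hF : hesseForm lam v = 0) (hZ : tangentForm lam v = 0) :
    toWeier (mk v hv hF : HesseCurve lam h) = 0 := by
  obtain ⟨a, ha⟩ := Projectivization.exists_smul_eq_mk_rep k v hv
  have : tangentForm lam (mk v hv hF : HesseCurve lam h).1.rep = 0 := by
    change tangentForm lam (Projectivization.mk k v hv).rep = 0
    rw [← ha, Units.smul_def, tangentForm_smul, hZ, mul_zero]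
  unfold toWeier
  rw [dif_pos this]

theorem some_congr {k : Type*} [Field k] {W : WeierstrassCurve.Affine k} {x y x' y' : k}
    {hxy : W.Nonsingular x y} {hxy' : W.Nonsingular x' y'} (hx : x = x') (hy : y = y') :
    WeierstrassCurve.Affine.Point.some x y hxy = .some x' y' hxy' := by
  subst hx hy
  rfl

theorem toWeier_mk_some {k : Type*} [Field k] [CharZero k] {lam : k} {h : lam ^ 3 ≠ 1}
    {v : Fin 3 → k} (hv : v ≠ 0) (hF : hesseForm lam v = 0) {x y : k}
    (hxy : (weier lam).Nonsingular x y) (hx : weierM lam * v 2 = x * tangentForm lam v)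
    (hy : weierM lam * (v 0 - v 1) = y * tangentForm lam v) :
    toWeier (mk v hv hF : HesseCurve lam h) = .some x y hxy := by
  have hm := weierM_ne_zero h
  have hZ : tangentForm lam v ≠ 0 := by
    intro hZ
    rw [hZ, mul_zero] at hx hy
    have h2 : v 2 = 0 := by simpa [hm] using hx
    have h01 : v 0 - v 1 = 0 := by simpa [hm] using hy
    have hs : v 0 + v 1 = 0 := by simpa [tangentForm, h2] using hZ
    refine vec_ne_zero hv ⟨?_, ?_, h2⟩
    · linear_combination hs / 2 + h01 / 2
    · linear_combination hs / 2 - h01 / 2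
  obtain ⟨a, ha⟩ := Projectivization.exists_smul_eq_mk_rep k v hv
  have hr : (mk v hv hF : HesseCurve lam h).1.rep = (a : k) • v := by
    rw [← Units.smul_def, ha]; rfl
  have : tangentForm lam (mk v hv hF : HesseCurve lam h).1.rep ≠ 0 := by
    rw [hr, tangentForm_smul]
    exact mul_ne_zero a.ne_zero hZ
  unfold toWeier
  rw [dif_neg this]
  have ha0 : (a : k) ≠ 0 := a.ne_zero
  apply some_congr
  · rw [hr, tangentForm_smul, Pi.smul_apply, smul_eq_mul]
    field_simp
    linear_combination hx
  · rw [hr, tangentForm_smul, Pi.smul_apply, Pi.smul_apply, smul_eq_mul, smul_eq_mul]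
    field_simp
    linear_combination hy

/-- The vector with `z = c`, `x - y = d` and `x + y + λ z = 1`. -/
def stdVec {k : Type*} [Field k] (lam c d : k) : Fin 3 → k :=
  ![(1 - lam * c + d) / 2, (1 - lam * c - d) / 2, c]

theorem tangentForm_stdVec {k : Type*} [Field k] [CharZero k] (lam c d : k) :
    tangentForm lam (stdVec lam c d) = 1 := by
  simp [tangentForm, stdVec]; ring

theorem stdVec_ne_zero {k : Type*} [Field k] [CharZero k] (lam c d : k) : stdVec lam c d ≠ 0 := by
  intro H
  have := tangentForm_stdVec lam c d
  rw [H] at this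
  simp [tangentForm] at this

theorem form_stdVec {k : Type*} [Field k] [CharZero k] {lam c d : k} :
    hesseForm lam (stdVec lam c d) = 0 ↔
      3 * d ^ 2 = 4 * (lam ^ 3 - 1) * c ^ 3 - 9 * lam ^ 2 * c ^ 2 + 6 * lam * c - 1 := by
  simp only [hesseForm, stdVec, Matrix.cons_val]
  constructor <;> intro H
  · linear_combination 4 * H
  · linear_combination H / 4

theorem eq_origin_or_std {k : Type*} [Field k] [CharZero k] {lam : k} {h : lam ^ 3 ≠ 1}
    (P : HesseCurve lam h) : P = origin ∨
      ∃ c d, ∃ hF : hesseForm lam (stdVec lam c d) = 0, P = mk _ (stdVec_ne_zero lam c d) hF := by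
  obtain ⟨v, hv, hF, rfl⟩ : ∃ v hv hF, P = mk v hv hF := ⟨_, _, _, (mk_rep P).symm⟩
  by_cases hZ : tangentForm lam v = 0
  · left
    have h2 : v 2 = 0 := by
      have : (lam ^ 3 - 1) * v 2 ^ 3 = 0 := by
        simp only [hesseForm, tangentForm] at hF hZ
        obtain hz : v 0 = - v 1 - lam * v 2 := by linear_combination hZ
        rw [hz] at hF
        linear_combination -hF
      simpa [sub_ne_zero.2 h] using this
    have h01 : v 0 + v 1 = 0 := by simpa [tangentForm, h2] using hZ
    refine mk_eq_mk (v 0) ?_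
    ext i
    fin_cases i
    · simp
    · simp; linear_combination -h01
    · simp [h2]
  · right
    have e : tangentForm lam v • stdVec lam (v 2 / tangentForm lam v)
        ((v 0 - v 1) / tangentForm lam v) = v := by
      ext i
      fin_cases i
      · simp [stdVec]; field_simp; simp [tangentForm]; ring
      · simp [stdVec]; field_simp; simp [tangentForm]; ring
      · simp [stdVec]; field_simp
    have hF' : hesseForm lam (stdVec lam (v 2 / tangentForm lam v)
        ((v 0 - v 1) / tangentForm lam v)) = 0 := by
      rw [← e, form_smul] at hF
      simpa [hZ] using hF
    exact ⟨_, _, hF', mk_eq_mk _ e⟩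

theorem toWeier_origin {k : Type*} [Field k] [CharZero k] {lam : k} {h : lam ^ 3 ≠ 1} :
    toWeier (origin : HesseCurve lam h) = 0 :=
  toWeier_mk_zero _ _ (by simp [tangentForm])

theorem std_nonsingular {k : Type*} [Field k] [CharZero k] {lam : k} (h : lam ^ 3 ≠ 1) {c d : k}
    (hF : hesseForm lam (stdVec lam c d) = 0) :
    (weier lam).Nonsingular (weierM lam * c) (weierM lam * d) := by
  have := weier_nonsingular h hF (by rw [tangentForm_stdVec]; exact one_ne_zero)
  rw [tangentForm_stdVec] at this
  convert this using 1
  · simp [stdVec]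
  · simp [stdVec]; left; ring

theorem toWeier_std {k : Type*} [Field k] [CharZero k] {lam : k} {h : lam ^ 3 ≠ 1} {c d : k}
    (hF : hesseForm lam (stdVec lam c d) = 0) :
    toWeier (mk _ (stdVec_ne_zero lam c d) hF : HesseCurve lam h) =
      .some _ _ (std_nonsingular h hF) := by
  apply toWeier_mk_some
  · rw [tangentForm_stdVec]; simp [stdVec]
  · rw [tangentForm_stdVec]; simp [stdVec]; left; ring

theorem toWeier_injective {k : Type*} [Field k] [CharZero k] {lam : k} {h : lam ^ 3 ≠ 1} :
    Function.Injective (toWeier : HesseCurve lam h → (weier lam).Point) := by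
  intro P Q hPQ
  have hm := weierM_ne_zero h
  rcases eq_origin_or_std P with rfl | ⟨c, d, hF, rfl⟩ <;>
    rcases eq_origin_or_std Q with rfl | ⟨e, f, hG, rfl⟩
  · rfl
  · rw [toWeier_origin, toWeier_std] at hPQ
    exact absurd hPQ.symm (WeierstrassCurve.Affine.Point.some_ne_zero _)
  · rw [toWeier_origin, toWeier_std] at hPQ
    exact absurd hPQ (WeierstrassCurve.Affine.Point.some_ne_zero _)
  · rw [toWeier_std, toWeier_std] at hPQ
    simp only [WeierstrassCurve.Affine.Point.some.injEq, mul_eq_mul_left_iff, hm, or_false] at hPQ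
    obtain ⟨rfl, rfl⟩ := hPQ
    rfl

theorem toWeier_tau1 {k : Type*} [Field k] [CharZero k] {lam : k} {h : lam ^ 3 ≠ 1}
    (P : HesseCurve lam h) : toWeier (tau1 P) = -toWeier P := by
  rcases eq_origin_or_std P with rfl | ⟨c, d, hF, rfl⟩
  · rw [toWeier_origin, WeierstrassCurve.Affine.Point.neg_zero, origin, tau1_mk]
    exact toWeier_mk_zero _ _ (by simp [tangentForm])
  · rw [tau1_mk, toWeier_std, WeierstrassCurve.Affine.Point.neg_some]
    apply toWeier_mk_some
    · simp [tangentForm, stdVec]; ring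
    · simp [tangentForm, stdVec, weier, WeierstrassCurve.Affine.negY]; ring

theorem add_eq_mk {k : Type*} [Field k] [CharZero k] {lam : k} {h : lam ^ 3 ≠ 1} {p q : Fin 3 → k}
    (hp : p ≠ 0) (hq : q ≠ 0) (hFp : hesseForm lam p = 0) (hFq : hesseForm lam q = 0) :
    ∃ v, ∃ hv : v ≠ 0, ∃ hF : hesseForm lam v = 0, (v = hesseAddFst p q ∨ v = hesseAddSnd p q) ∧
      add (mk p hp hFp : HesseCurve lam h) (mk q hq hFq) = mk v hv hF := by
  by_cases hv : hesseAddFst p q = 0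
  · exact ⟨_, _, _, Or.inr rfl, add_mk_snd hp hq hFp hFq hv⟩
  · exact ⟨_, _, _, Or.inl rfl, add_mk_fst hp hq hFp hFq hv⟩

theorem add_origin {k : Type*} [Field k] [CharZero k] {lam : k} {h : lam ^ 3 ≠ 1}
    (P : HesseCurve lam h) : add P origin = P := by
  obtain ⟨p, hp, hF, rfl⟩ : ∃ v hv hF, P = mk v hv hF := ⟨_, _, _, (mk_rep P).symm⟩
  obtain ⟨v, hv, hFv, hcase, e⟩ := add_eq_mk (h := h) hp origin_ne_zero hF
    (by simp [hesseForm]; ring : hesseForm lam ![1, -1, 0] = 0)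
  refine e.trans ?_
  rcases hcase with rfl | rfl
  · refine mk_eq_mk (p 2) ?_
    ext i
    fin_cases i <;> simp [hesseAddFst] <;> ring
  · refine mk_eq_mk (p 1) ?_
    ext i
    fin_cases i <;> simp [hesseAddSnd] <;> ring

theorem origin_add {k : Type*} [Field k] [CharZero k] {lam : k} {h : lam ^ 3 ≠ 1}
    (P : HesseCurve lam h) : add origin P = P := by
  obtain ⟨p, hp, hF, rfl⟩ : ∃ v hv hF, P = mk v hv hF := ⟨_, _, _, (mk_rep P).symm⟩
  obtain ⟨v, hv, hFv, hcase, e⟩ := add_eq_mk (h := h) origin_ne_zero hp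
    (by simp [hesseForm]; ring : hesseForm lam ![1, -1, 0] = 0) hF
  refine e.trans ?_
  rcases hcase with rfl | rfl
  · refine mk_eq_mk (-p 2) ?_
    ext i
    fin_cases i <;> simp [hesseAddFst] <;> try ring
  · refine mk_eq_mk (-p 0) ?_
    ext i
    fin_cases i <;> simp [hesseAddSnd] <;> ring

theorem add_std_chord {k : Type*} [Field k] [CharZero k] {lam c d e f : k}
    (hF : hesseForm lam (stdVec lam c d) = 0) (hG : hesseForm lam (stdVec lam e f) = 0)
    {v : Fin 3 → k} (hv : v = hesseAddFst (stdVec lam c d) (stdVec lam e f) ∨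
      v = hesseAddSnd (stdVec lam c d) (stdVec lam e f)) :
    (c - e) ^ 2 * weierM lam * v 2 = ((d - f) ^ 2 + (3 * lam ^ 2 - weierM lam * (c + e)) *
      (c - e) ^ 2) * tangentForm lam v ∧
    (c - e) * (v 0 - v 1) = -((c - e) * d * tangentForm lam v +
      (d - f) * (v 2 - c * tangentForm lam v)) := by
  have hm : 3 * weierM lam = 4 * (lam ^ 3 - 1) := by
    simp only [weierM]
    field_simp
  generalize weierM lam = m at *
  rw [form_stdVec] at hF hG
  rcases hv with rfl | rfl <;> simp only [hesseAddFst, hesseAddSnd, stdVec, tangentForm, Matrix.cons_val]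
  · constructor <;> grind
  · constructor
    · obtain rfl : m = 4 * (lam ^ 3 - 1) / 3 := by linear_combination hm / 3
      linear_combination ((-1/2) * lam ^ 4 * c * e ^ 3 + (1/3) * lam ^ 4 * e ^ 4 + (1/2) * lam
        ^ 3 * c ^ 2 * e * f + (-1/8) * lam ^ 3 * c ^ 2 * e + (1/2) * lam ^ 3 * c * d * e ^ 2 +
        (-1/2) * lam ^ 3 * c * e ^ 2 * f + (11/8) * lam ^ 3 * c * e ^ 2 + (-1/3) * lam ^ 3 * e
        ^ 3 * f + (-17/24) * lam ^ 3 * e ^ 3 + (-3/8) * lam ^ 2 * c ^ 2 * f + (1/8) * lam ^ 2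
        * c ^ 2 + (-3/4) * lam ^ 2 * c * d * e + (-1) * lam ^ 2 * c * e + (-3/8) * lam ^ 2 * d
        * e ^ 2 + (9/8) * lam ^ 2 * e ^ 2 * f + (1/4) * lam ^ 2 * e ^ 2 + (-1/4) * lam * c * d
        * f + (1/4) * lam * c * d + (1/2) * lam * c * e ^ 3 + (5/8) * lam * c * f ^ 2 + (1/4)
        * lam * c * f + (1/8) * lam * c + (-1/8) * lam * d ^ 2 * e + (1/2) * lam * d * e * f +
        (1/2) * lam * d * e + (-1/3) * lam * e ^ 4 + (-5/8) * lam * e * f ^ 2 + (-3/4) * lam *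
        e * f + (1/6) * lam * e + (-1/2) * c ^ 2 * e * f + (1/2) * c ^ 2 * e + (-1/2) * c * d
        * e ^ 2 + (1/2) * c * e ^ 2 * f + (-1) * c * e ^ 2 + (1/8) * d ^ 2 * f + (1/8) * d ^ 2
        + (-1/8) * d * f ^ 2 + (-1/4) * d * f + (-1/8) * d + (1/3) * e ^ 3 * f + (1/3) * e ^ 3
        + (-1/8) * f ^ 3 + (1/12) * f + (-1/24)) / 3 * hF + ((1/2) * lam ^ 4 * c ^ 4 + (-1/3)
        * lam ^ 4 * c ^ 3 * e + (-1/2) * lam ^ 3 * c ^ 3 * d + (-1/6) * lam ^ 3 * c ^ 3 * f +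
        (-7/6) * lam ^ 3 * c ^ 3 + (-1/2) * lam ^ 3 * c ^ 2 * d * e + (1/2) * lam ^ 3 * c ^ 2
        * e * f + (1/2) * lam ^ 3 * c ^ 2 * e + (1/2) * lam ^ 3 * c * d * e ^ 2 + (1/8) * lam
        ^ 3 * c * e ^ 2 + (3/2) * lam ^ 2 * c ^ 2 * d + 1 * lam ^ 2 * c ^ 2 + (-3/4) * lam ^ 2
        * c * e * f + (-1/4) * lam ^ 2 * c * e + (-3/8) * lam ^ 2 * d * e ^ 2 + (-1/8) * lam ^
        2 * e ^ 2 + (-1/2) * lam * c ^ 4 + (1/3) * lam * c ^ 3 * e + (-1/2) * lam * c * d * f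
        + (-1) * lam * c * d + (1/8) * lam * c * f ^ 2 + (1/4) * lam * c * f + (-3/8) * lam *
        c + (1/4) * lam * d * e * f + (1/4) * lam * d * e + (1/4) * lam * e * f + (1/12) * lam
        * e + (1/2) * c ^ 3 * d + (1/6) * c ^ 3 * f + (-1/3) * c ^ 3 + (1/2) * c ^ 2 * d * e +
        (-1/2) * c ^ 2 * e * f + 1 * c ^ 2 * e + (-1/2) * c * d * e ^ 2 + (-1/2) * c * e ^ 2 +
        (1/8) * d * f ^ 2 + (1/4) * d * f + (1/8) * d + (-1/8) * f ^ 2 + (-1/12) * f + (1/24))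
        / 3 * hG
    · grind

theorem add_std_opp {k : Type*} [Field k] [CharZero k] {lam c d : k} {v : Fin 3 → k}
    (hv : v = hesseAddFst (stdVec lam c d) (stdVec lam c (-d)) ∨
      v = hesseAddSnd (stdVec lam c d) (stdVec lam c (-d))) : tangentForm lam v = 0 := by
  rcases hv with rfl | rfl <;> simp [hesseAddFst, hesseAddSnd, stdVec, tangentForm] <;> ring

theorem add_std_dbl {k : Type*} [Field k] [CharZero k] {lam c d : k}
    (hF : hesseForm lam (stdVec lam c d) = 0) {v : Fin 3 → k} (hv0 : v ≠ 0)
    (hv : v = hesseAddFst (stdVec lam c d) (stdVec lam c d) ∨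
      v = hesseAddSnd (stdVec lam c d) (stdVec lam c d)) :
    4 * d ^ 2 * weierM lam * v 2 = ((3 * weierM lam * c ^ 2 - 6 * lam ^ 2 * c + 2 * lam) ^ 2 +
      4 * d ^ 2 * (3 * lam ^ 2 - 2 * weierM lam * c)) * tangentForm lam v ∧
    2 * d * (v 0 - v 1) = -(2 * d ^ 2 * tangentForm lam v +
      (3 * weierM lam * c ^ 2 - 6 * lam ^ 2 * c + 2 * lam) *
        (v 2 - c * tangentForm lam v)) := by
  have hm : 3 * weierM lam = 4 * (lam ^ 3 - 1) := by
    simp only [weierM]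
    field_simp
  generalize weierM lam = m at *
  rw [form_stdVec] at hF
  rcases hv with rfl | rfl
  · exfalso
    apply hv0
    ext i
    fin_cases i <;> simp [hesseAddFst] <;> ring
  · clear hv0
    simp only [hesseAddSnd, stdVec, tangentForm, Matrix.cons_val]
    constructor <;> grind

open Classical in
theorem toWeier_add {k : Type*} [Field k] [CharZero k] {lam : k} {h : lam ^ 3 ≠ 1}
    (P Q : HesseCurve lam h) : toWeier (add P Q) = toWeier P + toWeier Q := by
  have hm := weierM_ne_zero h
  rcases eq_origin_or_std P with rfl | ⟨c, d, hF, rfl⟩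
  · rw [toWeier_origin, _root_.zero_add, origin_add]
  rcases eq_origin_or_std Q with rfl | ⟨e, f, hG, rfl⟩
  · rw [toWeier_origin, _root_.add_zero, add_origin]
  obtain ⟨v, hv, hFv, hcase, he⟩ := add_eq_mk (h := h) (stdVec_ne_zero lam c d)
    (stdVec_ne_zero lam e f) hF hG
  rw [he, toWeier_std, toWeier_std]
  by_cases hce : c = e
  · subst hce
    have hdf : (d - f) * (d + f) = 0 := by
      have h1 := form_stdVec.1 hF
      have h2 := form_stdVec.1 hG
      linear_combination (h1 - h2) / 3
    by_cases hopp : f = -d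
    · subst hopp
      rw [WeierstrassCurve.Affine.Point.add_of_Y_eq rfl
        (by simp [WeierstrassCurve.Affine.negY, weier])]
      exact toWeier_mk_zero _ _ (add_std_opp hcase)
    · have hfd : f = d := by
        rcases mul_eq_zero.1 hdf with h1 | h1
        · linear_combination -h1
        · exact absurd (by linear_combination h1) hopp
      subst hfd
      have hf : f ≠ 0 := by
        rintro rfl
        simp at hopp
      have hy : weierM lam * f ≠ (weier lam).negY (weierM lam * c) (weierM lam * f) := by
        simp only [WeierstrassCurve.Affine.negY, weier, zero_mul, sub_zero]
        intro H
        have : weierM lam * f = 0 := by linear_combination H / 2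
        simp [hm, hf] at this
      rw [WeierstrassCurve.Affine.Point.add_of_Y_ne hy]
      obtain ⟨hX, hY⟩ := add_std_dbl hF hv hcase
      have hs : (weier lam).slope (weierM lam * c) (weierM lam * c) (weierM lam * f)
          (weierM lam * f) = (3 * weierM lam * c ^ 2 - 6 * lam ^ 2 * c + 2 * lam) / (2 * f) := by
        rw [WeierstrassCurve.Affine.slope_of_Y_ne rfl hy]
        simp only [WeierstrassCurve.Affine.negY, weier]
        field_simp
        ring
      have hX' : weierM lam * v 2 = (weier lam).addX (weierM lam * c) (weierM lam * c)
          ((3 * weierM lam * c ^ 2 - 6 * lam ^ 2 * c + 2 * lam) / (2 * f)) *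
            tangentForm lam v := by
        simp only [WeierstrassCurve.Affine.addX, weier]
        field_simp
        linear_combination hX
      apply toWeier_mk_some
      · rw [hs]
        exact hX'
      · rw [hs]
        simp only [WeierstrassCurve.Affine.addY, WeierstrassCurve.Affine.negAddY,
          WeierstrassCurve.Affine.negY]
        generalize (weier lam).addX (weierM lam * c) (weierM lam * c)
          ((3 * weierM lam * c ^ 2 - 6 * lam ^ 2 * c + 2 * lam) / (2 * f)) = x3 at *
        simp only [weier]
        field_simp
        linear_combination weierM lam * hY -
          (3 * weierM lam * c ^ 2 - 6 * lam ^ 2 * c + 2 * lam) * hX'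
  · have hx : weierM lam * c ≠ weierM lam * e := by simpa [hm] using hce
    have hce' := sub_ne_zero.2 hce
    rw [WeierstrassCurve.Affine.Point.add_of_X_ne hx]
    obtain ⟨hX, hY⟩ := add_std_chord hF hG hcase
    have hs : (weier lam).slope (weierM lam * c) (weierM lam * e) (weierM lam * d)
        (weierM lam * f) = (d - f) / (c - e) := by
      rw [WeierstrassCurve.Affine.slope_of_X_ne hx, ← mul_sub, ← mul_sub, mul_div_mul_left _ _ hm]
    have hX' : weierM lam * v 2 = (weier lam).addX (weierM lam * c) (weierM lam * e)
        ((d - f) / (c - e)) * tangentForm lam v := by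
      simp only [WeierstrassCurve.Affine.addX, weier]
      field_simp
      linear_combination hX
    apply toWeier_mk_some
    · rw [hs]
      exact hX'
    · rw [hs]
      simp only [WeierstrassCurve.Affine.addY, WeierstrassCurve.Affine.negAddY,
        WeierstrassCurve.Affine.negY]
      generalize (weier lam).addX (weierM lam * c) (weierM lam * e)
        ((d - f) / (c - e)) = x3 at *
      simp only [weier]
      field_simp
      linear_combination weierM lam * hY - (d - f) * hX'

noncomputable instance {k : Type*} [Field k] [CharZero k] {lam : k} {h : lam ^ 3 ≠ 1} :
    Zero (HesseCurve lam h) := ⟨origin⟩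

noncomputable instance {k : Type*} [Field k] [CharZero k] {lam : k} {h : lam ^ 3 ≠ 1} :
    Add (HesseCurve lam h) := ⟨add⟩

noncomputable instance {k : Type*} [Field k] [CharZero k] {lam : k} {h : lam ^ 3 ≠ 1} :
    Neg (HesseCurve lam h) := ⟨tau1⟩

open Classical in
/-- The group structure of the Hesse cubic: zero element `(1 : -1 : 0)`, addition by the addition
formulas, negation `(a : b : c) ↦ (b : a : c)`. -/
noncomputable instance {k : Type*} [Field k] [CharZero k] {lam : k} {h : lam ^ 3 ≠ 1} :
    AddCommGroup (HesseCurve lam h) where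
  add_assoc P Q R := toWeier_injective (by
    change toWeier (add (add P Q) R) = toWeier (add P (add Q R))
    simp only [toWeier_add, _root_.add_assoc])
  zero_add P := origin_add P
  add_zero P := add_origin P
  neg_add_cancel P := toWeier_injective (by
    change toWeier (add (tau1 P) P) = toWeier origin
    rw [toWeier_add, toWeier_tau1, toWeier_origin, _root_.neg_add_cancel])
  add_comm P Q := toWeier_injective (by
    change toWeier (add P Q) = toWeier (add Q P)
    simp only [toWeier_add, _root_.add_comm])
  nsmul := nsmulRec
  zsmul := zsmulRec

theorem form_tau2 {k : Type*} [Field k] {ε : k} (hε : IsPrimitiveRoot ε 3) {v : Fin 3 → k}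
    (hv : hesseForm 0 v = 0) : hesseForm 0 ![v 1, v 0, v 2 * ε] = 0 := by
  have h3 := hε.pow_eq_one
  simp only [hesseForm, Matrix.cons_val] at *
  linear_combination hv + v 2 ^ 3 * h3

theorem tau2_ne_zero {k : Type*} [Field k] {ε : k} (hε : IsPrimitiveRoot ε 3) {v : Fin 3 → k}
    (hv : v ≠ 0) : ![v 1, v 0, v 2 * ε] ≠ 0 := by
  intro h
  have h0 := congrFun h 0
  have h1 := congrFun h 1
  have h2 := congrFun h 2
  have := hε.ne_zero (by norm_num)
  simp [this] at h0 h1 h2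
  exact vec_ne_zero hv ⟨h1, h0, h2⟩

theorem zero_cube_ne_one {k : Type*} [Field k] : (0 : k) ^ 3 ≠ 1 := by simp

/-- The automorphism `τ₂(a : b : c) = (b : a : c ε)` of the Hesse cubic with `λ = 0`, for a
primitive third root of unity `ε`. -/
noncomputable def tau2 {k : Type*} [Field k] {ε : k} (hε : IsPrimitiveRoot ε 3)
    (P : HesseCurve (0 : k) zero_cube_ne_one) : HesseCurve (0 : k) zero_cube_ne_one :=
  mk ![P.1.rep 1, P.1.rep 0, P.1.rep 2 * ε] (tau2_ne_zero hε P.1.rep_nonzero) (form_tau2 hε P.2)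

theorem tau2_mk {k : Type*} [Field k] {ε : k} (hε : IsPrimitiveRoot ε 3) (v : Fin 3 → k)
    (hv : v ≠ 0) (hF : hesseForm 0 v = 0) :
    tau2 hε (mk v hv hF) = mk ![v 1, v 0, v 2 * ε] (tau2_ne_zero hε hv) (form_tau2 hε hF) := by
  obtain ⟨a, ha⟩ := Projectivization.exists_smul_eq_mk_rep k v hv
  refine mk_eq_mk (a : k) ?_
  change _ = ![(Projectivization.mk k v hv).rep 1, (Projectivization.mk k v hv).rep 0,
    (Projectivization.mk k v hv).rep 2 * ε]
  rw [← ha]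
  ext i
  fin_cases i <;> simp [Units.smul_def, mul_assoc]

theorem sum_primitive_cube {k : Type*} [Field k] {ε : k} (hε : IsPrimitiveRoot ε 3) :
    ε ^ 2 + ε + 1 = 0 := by
  have h := hε.geom_sum_eq_zero (by norm_num)
  simp [Finset.sum_range_succ] at h
  linear_combination h

theorem form_tau3 {k : Type*} [Field k] {s ε : k} (hs : s ^ 2 = 3) (hε : IsPrimitiveRoot ε 3)
    {v : Fin 3 → k} (hv : hesseForm (1 + s) v = 0) :
    hesseForm (1 + s) ![v 0 * ε ^ 2 + v 1 * ε + v 2, v 0 * ε + v 1 * ε ^ 2 + v 2,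
      v 0 + v 1 + v 2] = 0 := by
  have h1 := sum_primitive_cube hε
  obtain ⟨d, rfl⟩ : ∃ d, d = ε := ⟨ε, rfl⟩
  simp only [hesseForm, Matrix.cons_val] at *
  generalize v 0 = a at *
  generalize v 1 = b at *
  generalize v 2 = c at *
  clear hε
  have h2 : d ^ 2 = -d - 1 := by linear_combination h1
  rw [h2]
  grind

theorem tau3_ne_zero {k : Type*} [Field k] [CharZero k] {ε : k} (hε : IsPrimitiveRoot ε 3)
    {v : Fin 3 → k} (hv : v ≠ 0) :
    ![v 0 * ε ^ 2 + v 1 * ε + v 2, v 0 * ε + v 1 * ε ^ 2 + v 2, v 0 + v 1 + v 2] ≠ 0 := by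
  intro h
  have h0 := congrFun h 0
  have h1 := congrFun h 1
  have h2 := congrFun h 2
  simp only [Matrix.cons_val, Pi.zero_apply] at h0 h1 h2
  have hs := sum_primitive_cube hε
  have h3 := hε.pow_eq_one
  refine vec_ne_zero hv ⟨?_, ?_, ?_⟩
  · linear_combination (ε * h0 + ε ^ 2 * h1 + h2) / 3 - (2 * v 0 + v 1 * ε) / 3 * h3 -
      (v 1 + v 2) / 3 * hs
  · linear_combination (ε ^ 2 * h0 + ε * h1 + h2) / 3 - (2 * v 1 + v 0 * ε) / 3 * h3 -
      (v 0 + v 2) / 3 * hs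
  · linear_combination (h0 + h1 + h2) / 3 - (v 0 + v 1) / 3 * hs

theorem one_add_sqrt_cube_ne_one {k : Type*} [Field k] [CharZero k] {s : k} (hs : s ^ 2 = 3) :
    (1 + s) ^ 3 ≠ 1 := by
  intro h
  have h1 : 2 * s = -3 := by linear_combination (h - (s + 3) * hs) / 3
  have h2 : (3 : k) = 0 := by linear_combination (2 * s - 3) * h1 - 4 * hs
  norm_num at h2

/-- The automorphism `τ₃(a : b : c) = (a ε² + b ε + c : a ε + b ε² + c : a + b + c)` of the Hesse
cubic with `λ = 1 + √3`, for a primitive third root of unity `ε`; here `s = √3`. -/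
noncomputable def tau3 {k : Type*} [Field k] [CharZero k] {s ε : k} (hs : s ^ 2 = 3)
    (hε : IsPrimitiveRoot ε 3) (P : HesseCurve (1 + s) (one_add_sqrt_cube_ne_one hs)) :
    HesseCurve (1 + s) (one_add_sqrt_cube_ne_one hs) :=
  mk ![P.1.rep 0 * ε ^ 2 + P.1.rep 1 * ε + P.1.rep 2, P.1.rep 0 * ε + P.1.rep 1 * ε ^ 2 + P.1.rep 2,
    P.1.rep 0 + P.1.rep 1 + P.1.rep 2] (tau3_ne_zero hε P.1.rep_nonzero) (form_tau3 hs hε P.2)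

theorem tau3_mk {k : Type*} [Field k] [CharZero k] {s ε : k} (hs : s ^ 2 = 3)
    (hε : IsPrimitiveRoot ε 3) (v : Fin 3 → k) (hv : v ≠ 0) (hF : hesseForm (1 + s) v = 0) :
    tau3 hs hε (mk v hv hF) = mk ![v 0 * ε ^ 2 + v 1 * ε + v 2, v 0 * ε + v 1 * ε ^ 2 + v 2,
      v 0 + v 1 + v 2] (tau3_ne_zero hε hv) (form_tau3 hs hε hF) := by
  obtain ⟨a, ha⟩ := Projectivization.exists_smul_eq_mk_rep k v hv
  refine mk_eq_mk (a : k) ?_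
  change _ = ![(Projectivization.mk k v hv).rep 0 * ε ^ 2 + (Projectivization.mk k v hv).rep 1 * ε +
    (Projectivization.mk k v hv).rep 2, (Projectivization.mk k v hv).rep 0 * ε +
    (Projectivization.mk k v hv).rep 1 * ε ^ 2 + (Projectivization.mk k v hv).rep 2,
    (Projectivization.mk k v hv).rep 0 + (Projectivization.mk k v hv).rep 1 +
    (Projectivization.mk k v hv).rep 2]
  rw [← ha]
  ext i
  fin_cases i <;> simp [Units.smul_def] <;> ring

/-- The set `U_τ = {p ∈ E ∣ p - τ(p) ∈ E[3]}`. -/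
def USet {k : Type*} [Field k] [CharZero k] {lam : k} {h : lam ^ 3 ≠ 1}
    (τ : HesseCurve lam h → HesseCurve lam h) : Set (HesseCurve lam h) :=
  {P | P - τ P ∈ AddSubgroup.torsionBy (HesseCurve lam h) 3}

/-- The set `E_τ = {p ∈ E ∣ τ(p) = p}`. -/
def fixedSet {k : Type*} [Field k] {lam : k} {h : lam ^ 3 ≠ 1}
    (τ : HesseCurve lam h → HesseCurve lam h) : Set (HesseCurve lam h) :=
  {P | τ P = P}

theorem vec_third_ne_zero {k : Type*} [Field k] {a b c : k} (hc : c ≠ 0) : ![a, b, c] ≠ 0 := by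
  intro h
  exact hc (by simpa using congrFun h 2)

theorem form_pointQ {k : Type*} [Field k] {η : k} (hη : IsPrimitiveRoot η 9) :
    hesseForm 0 ![η ^ 8, η ^ 4, 1] = 0 := by
  have h3 : IsPrimitiveRoot (η ^ 3) 3 := hη.pow (by norm_num) (by norm_num)
  have h1 := sum_primitive_cube h3
  have h9 := hη.pow_eq_one
  simp only [hesseForm, Matrix.cons_val]
  linear_combination h1 + (η ^ 15 + η ^ 6 + η ^ 3) * h9

/-- The point `q = (η⁸ : η⁴ : 1)` of the Hesse cubic with `λ = 0`, for a primitive ninth root of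
unity `η`. -/
def pointQ {k : Type*} [Field k] {η : k} (hη : IsPrimitiveRoot η 9) :
    HesseCurve (0 : k) zero_cube_ne_one :=
  mk ![η ^ 8, η ^ 4, 1] (vec_third_ne_zero one_ne_zero) (form_pointQ hη)

theorem form_pointB {k : Type*} [Field k] {s : k} (hs : s ^ 2 = 3) :
    hesseForm (1 + s) ![1, 1, 1 + s] = 0 := by
  simp only [hesseForm, Matrix.cons_val]
  linear_combination s * hs

theorem pointB_ne_zero {k : Type*} [Field k] {s : k} : ![1, 1, 1 + s] ≠ 0 := by
  intro h
  simpa using congrFun h 0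

/-- The point `(1 : 1 : λ)` of the Hesse cubic with `λ = 1 + √3`; here `s = √3`. -/
def pointB {k : Type*} [Field k] [CharZero k] {s : k} (hs : s ^ 2 = 3) :
    HesseCurve (1 + s) (one_add_sqrt_cube_ne_one hs) :=
  mk ![1, 1, 1 + s] pointB_ne_zero (form_pointB hs)

/-- The set `{τ₂ˡ(q) + r ∣ l ∈ ℤ/6, r ∈ E_{τ₂²}}`. -/
def orbitQ {k : Type*} [Field k] [CharZero k] {ε η : k} (hε : IsPrimitiveRoot ε 3)
    (hη : IsPrimitiveRoot η 9) : Set (HesseCurve (0 : k) zero_cube_ne_one) :=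
  {P | ∃ l : Fin 6, ∃ r ∈ fixedSet (tau2 hε)^[2], P = (tau2 hε)^[l] (pointQ hη) + r}

end HesseCurve

/-! The first case is immediate: `tau1` is the negation, so `p - τ₁(p) = 2p`. In the other two cases
everything follows from one quadratic relation in the endomorphism ring, `τ₂² = τ₂ - 1` and `τ₃² =
-1`, together with the fixed points of `τ₂²` and of `τ₃`.

To use such a relation, `τ` must be known to be additive. In the coordinates of `weier`, both
automorphisms have the form `(x, y) ↦ (α x + β, γ y)`. Such a map scales all chord and tangent
slopes by `γ / α` and hence respects the group law (`pointAffineMap_add`, `tau2_add`, `tau3_add`).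

If `T² = T - 1`, then `T` acts as a primitive sixth root of unity. The operators `1 - T = -T²` and
`1 - T⁵ = T` are injective, so for `i = 1, 5` the condition is just `3p = 0`; for `i = 3` one has
`T³ = -1`. Put `π = 2 - T = 1 - T²`. Then `π² = 3(1 - T)` is 3 up to a unit, so the torsion group
`E[3]` is `ker π²` while `U` for `i = 2, 4` is `ker π³`. Since `ker π` consists of the fixed points
of `T²` and is `{0, y, -y}` for any nonzero `y` in it, a single `q` in `ker π³` outside `ker π²`
generates the rest: the six elements `Tˡq` represent the cosets of `ker π` in the complement
(`torsion_sub_iterate_two_iff_exists`, `ncard_orbit`). That the given `q` qualifies is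
`pointQ_not_torsion`.

If `T² = -1` and the fixed points of `T` are `0` and `b`, then `3(p - Tp) = 0` says that `3p` is
fixed, and `p = 3p - 2p` splits `p` into a multiple of `b` and a 3-torsion point
(`torsion_sub_iff_of_quartic`). -/

/-! ### Additivity of affine self-maps of a Weierstrass cubic. -/

open WeierstrassCurve in
/-- The self-map of a Weierstrass curve given by `(x, y) ↦ (α x + β, γ y)`. -/
def pointAffineMap {k : Type*} [Field k] {W : Affine k} {α β γ : k}
    (hW : ∀ x y, W.Nonsingular x y → W.Nonsingular (α * x + β) (γ * y)) : W.Point → W.Point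
  | .zero => .zero
  | .some _ _ h => .some _ _ (hW _ _ h)

-- The conditions `hαγ`, `h₂`, `h₄` compare coefficients when `(α x + β, γ y)` is substituted into
-- `y² = x³ + a₂ x² + a₄ x + a₆`. No condition on `a₆` is needed beyond `hW`, because chord and
-- tangent formulas do not involve `a₆`.
open WeierstrassCurve Classical in
theorem pointAffineMap_add {k : Type*} [Field k] [CharZero k] {W : Affine k} (h₁ : W.a₁ = 0)
    (h₃ : W.a₃ = 0) {α β γ : k} (hα : α ≠ 0) (hγ : γ ≠ 0) (hαγ : γ ^ 2 = α ^ 3)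
    (h₂ : α * W.a₂ = W.a₂ + 3 * β) (h₄ : 3 * β ^ 2 + 2 * W.a₂ * β + W.a₄ = α ^ 2 * W.a₄)
    (hW : ∀ x y, W.Nonsingular x y → W.Nonsingular (α * x + β) (γ * y)) (P Q : W.Point) :
    pointAffineMap hW (P + Q) = pointAffineMap hW P + pointAffineMap hW Q := by
  rcases P with _ | ⟨x₁, y₁, hP⟩
  · change pointAffineMap hW (0 + Q) = 0 + pointAffineMap hW Q
    rw [zero_add, zero_add]
  rcases Q with _ | ⟨x₂, y₂, hQ⟩
  · change pointAffineMap hW (.some x₁ y₁ hP + 0) = pointAffineMap hW (.some x₁ y₁ hP) + 0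
    rw [add_zero, add_zero]
  have hneg : ∀ x y : k, W.negY x y = -y := fun x y => by simp [Affine.negY, h₁, h₃]
  -- Once the slope is multiplied by `γ / α`, the formulas for the third point transform by the same
  -- affine map; only the slope remains to be checked.
  have hsum : ∀ (x y x' y' l : k), W.addX (α * x + β) (α * x' + β) (γ / α * l) =
      α * W.addX x x' l + β ∧ W.addY (α * x + β) (α * x' + β) (γ * y) (γ / α * l) =
      γ * W.addY x x' y l := by
    intro x y x' y' l
    have hX : W.addX (α * x + β) (α * x' + β) (γ / α * l) = α * W.addX x x' l + β := by
      simp only [Affine.addX, h₁]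
      field_simp
      linear_combination l ^ 2 * hαγ + α ^ 2 * h₂
    refine ⟨hX, ?_⟩
    simp only [Affine.addY, Affine.negAddY, hneg, hX]
    field_simp
    ring
  have hpt : ∀ {x y x' y' : k} (hxy : ¬(x = x' ∧ y = W.negY x' y')),
      ¬(α * x + β = α * x' + β ∧ γ * y = W.negY (α * x' + β) (γ * y')) := by
    intro x y x' y' hxy
    rw [hneg] at hxy ⊢
    simpa [hα, hγ, ← mul_neg] using hxy
  by_cases hxy : x₁ = x₂ ∧ y₁ = W.negY x₂ y₂
  · rw [Affine.Point.add_of_Y_eq hxy.1 hxy.2]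
    refine (Affine.Point.add_of_Y_eq (by rw [hxy.1]) ?_).symm
    rw [hxy.2, hneg, hneg, mul_neg]
  · rw [Affine.Point.add_some hxy]
    change Affine.Point.some _ _ _ = Affine.Point.some _ _ _ + Affine.Point.some _ _ _
    rw [Affine.Point.add_some (hpt hxy)]
    -- For a chord this is immediate; for a tangent, `h₂` and `h₄` say that the derivative of the
    -- cubic transforms correctly.
    have hl : W.slope (α * x₁ + β) (α * x₂ + β) (γ * y₁) (γ * y₂) =
        γ / α * W.slope x₁ x₂ y₁ y₂ := by
      by_cases hx : x₁ = x₂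
      · have hy : y₁ ≠ W.negY x₂ y₂ := fun hy => hxy ⟨hx, hy⟩
        rw [Affine.slope_of_Y_ne hx hy, Affine.slope_of_Y_ne (by rw [hx])
          (by rw [hneg] at hy ⊢; simpa [hγ, ← mul_neg] using hy)]
        obtain rfl := Affine.Y_eq_of_Y_ne hP.1 hQ.1 hx hy
        subst hx
        rw [hneg] at hy
        have : y₁ ≠ 0 := fun h0 => hy (by simp [h0])
        simp only [hneg, h₁]
        have h2 : y₁ - -y₁ ≠ 0 := by simpa [← two_mul] using this
        have h3 : γ * y₁ - -(γ * y₁) ≠ 0 := by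
          rw [← mul_neg, ← mul_sub]; exact mul_ne_zero hγ h2
        rw [div_mul_div_comm, div_eq_div_iff h3 (mul_ne_zero hα h2)]
        linear_combination 2 * α * y₁ * h₄ - 4 * α ^ 2 * x₁ * y₁ * h₂ -
          (4 * x₁ * W.a₂ * y₁ + 6 * x₁ ^ 2 * y₁ + 2 * W.a₄ * y₁) * hαγ
      · have hx' : α * x₁ + β ≠ α * x₂ + β := by simpa [hα] using hx
        rw [Affine.slope_of_X_ne hx, Affine.slope_of_X_ne hx']
        have h2 := sub_ne_zero.2 hx
        have : α * x₁ + β - (α * x₂ + β) = α * (x₁ - x₂) := by ring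
        rw [this, ← mul_sub]
        field_simp
    obtain ⟨hX, hY⟩ := hsum x₁ y₁ x₂ y₂ (W.slope x₁ x₂ y₁ y₂)
    rw [← hl] at hX hY
    exact HesseCurve.some_congr hX.symm hY.symm

/-! ### `τ₂` and `τ₃` in Weierstrass coordinates. -/

namespace HesseCurve

/-- Since the discriminant is nonzero, only the equation has to be preserved; the hypotheses match
the coefficients of `y²`, `x²`, `x` and 1. -/
theorem weier_affine_nonsingular {k : Type*} [Field k] [CharZero k] {lam : k} (h : lam ^ 3 ≠ 1)
    {α β γ : k} (hαγ : γ ^ 2 = α ^ 3) (h₂ : α * (weier lam).a₂ = (weier lam).a₂ + 3 * β)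
    (h₄ : 3 * β ^ 2 + 2 * (weier lam).a₂ * β + (weier lam).a₄ = α ^ 2 * (weier lam).a₄)
    (h₆ : β ^ 3 + (weier lam).a₂ * β ^ 2 + (weier lam).a₄ * β + (weier lam).a₆ =
      α ^ 3 * (weier lam).a₆) (x y : k) (hxy : (weier lam).Nonsingular x y) :
    (weier lam).Nonsingular (α * x + β) (γ * y) := by
  rw [← WeierstrassCurve.Affine.equation_iff_nonsingular_of_Δ_ne_zero (weier_disc h),
    WeierstrassCurve.Affine.equation_iff] at hxy ⊢
  have h1 : (weier lam).a₁ = 0 := rfl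
  have h3 : (weier lam).a₃ = 0 := rfl
  rw [h1, h3] at hxy ⊢
  linear_combination α ^ 3 * hxy + y ^ 2 * hαγ + α ^ 2 * x ^ 2 * h₂ - α * x * h₄ - h₆

open Classical in
/-- A self-map of the Hesse cubic which is affine in Weierstrass coordinates is additive. -/
theorem map_add_of_toWeier {k : Type*} [Field k] [CharZero k] {lam : k} {h : lam ^ 3 ≠ 1}
    {α β γ : k} (hα : α ≠ 0) (hγ : γ ≠ 0) (hαγ : γ ^ 2 = α ^ 3)
    (h₂ : α * (weier lam).a₂ = (weier lam).a₂ + 3 * β)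
    (h₄ : 3 * β ^ 2 + 2 * (weier lam).a₂ * β + (weier lam).a₄ = α ^ 2 * (weier lam).a₄)
    (hW : ∀ x y, (weier lam).Nonsingular x y → (weier lam).Nonsingular (α * x + β) (γ * y))
    {τ : HesseCurve lam h → HesseCurve lam h}
    (hτ : ∀ P, toWeier (τ P) = pointAffineMap hW (toWeier P)) (P Q : HesseCurve lam h) :
    τ (P + Q) = τ P + τ Q := by
  apply toWeier_injective
  have hadd : ∀ P Q : HesseCurve lam h, toWeier (P + Q) = toWeier P + toWeier Q := toWeier_add
  rw [hτ, hadd, pointAffineMap_add rfl rfl hα hγ hαγ h₂ h₄, hadd, hτ, hτ]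

theorem tau2_add {k : Type*} [Field k] [CharZero k] {ε : k} (hε : IsPrimitiveRoot ε 3)
    (P Q : HesseCurve (0 : k) zero_cube_ne_one) : tau2 hε (P + Q) = tau2 hε P + tau2 hε Q := by
  -- For `λ = 0`, `X = m z / (x + y)` is multiplied by `ε` and `Y = m (x - y) / (x + y)` changes
  -- sign, so `α = ε`, `β = 0`, `γ = -1`.
  have hαγ : (-1 : k) ^ 2 = ε ^ 3 := by rw [hε.pow_eq_one]; norm_num
  have h₂ : ε * (weier (0 : k)).a₂ = (weier (0 : k)).a₂ + 3 * 0 := by simp [weier]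
  have h₄ : 3 * 0 ^ 2 + 2 * (weier (0 : k)).a₂ * 0 + (weier (0 : k)).a₄ =
    ε ^ 2 * (weier (0 : k)).a₄ := by simp [weier]
  have hW := weier_affine_nonsingular zero_cube_ne_one hαγ h₂ h₄ (by rw [hε.pow_eq_one]; ring)
  refine map_add_of_toWeier (hε.ne_zero (by norm_num)) (by norm_num) hαγ h₂ h₄ hW ?_ P Q
  intro P
  rcases eq_origin_or_std P with rfl | ⟨c, d, hF, rfl⟩
  · rw [toWeier_origin, origin, tau2_mk]
    exact toWeier_mk_zero _ _ (by simp [tangentForm])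
  · rw [tau2_mk, toWeier_std]
    apply toWeier_mk_some
    · simp [tangentForm, stdVec]; ring
    · simp [tangentForm, stdVec]; ring

theorem tau3_add {k : Type*} [Field k] [CharZero k] {s ε : k} (hs : s ^ 2 = 3)
    (hε : IsPrimitiveRoot ε 3) (P Q : HesseCurve (1 + s) (one_add_sqrt_cube_ne_one hs)) :
    tau3 hs hε (P + Q) = tau3 hs hε P + tau3 hs hε Q := by
  have hs0 : s ≠ 0 := by rintro rfl; norm_num at hs
  have h1 := sum_primitive_cube hε
  have h3 := hε.pow_eq_one
  -- A square root of -3; divided by `s = √3` it gives a square root of -1, which will be `γ`.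
  have hu : (ε ^ 2 - ε) ^ 2 = -3 := by linear_combination (ε - 2) * h3 + h1
  have hu0 : ε ^ 2 - ε ≠ 0 := by intro h; rw [h] at hu; norm_num at hu
  have hm : weierM (1 + s) = 8 * s + 12 := by
    simp only [weierM]; linear_combination (4 * s / 3 + 4) * hs
  have hαγ : ((ε ^ 2 - ε) / s) ^ 2 = (-1 : k) ^ 3 := by
    rw [div_pow, hu, hs]; norm_num
  -- With `α = -1`, this condition forces `β = -2 a₂ / 3 = 2 λ²`: the map on `X` is the reflection
  -- in `λ²`, the mean of the roots of the cubic.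
  have h₂ : -1 * (weier (1 + s)).a₂ = (weier (1 + s)).a₂ + 3 * (2 * (1 + s) ^ 2) := by
    simp only [weier]; ring
  have h₄ : 3 * (2 * (1 + s) ^ 2) ^ 2 + 2 * (weier (1 + s)).a₂ * (2 * (1 + s) ^ 2) +
      (weier (1 + s)).a₄ = (-1) ^ 2 * (weier (1 + s)).a₄ := by
    simp only [weier]; ring
  have hW := weier_affine_nonsingular (one_add_sqrt_cube_ne_one hs) hαγ h₂ h₄ (by
    simp only [weier, hm]; grind)
  refine map_add_of_toWeier (by norm_num) (div_ne_zero hu0 hs0) hαγ h₂ h₄ hW ?_ P Q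
  intro P
  rcases eq_origin_or_std P with rfl | ⟨c, d, hF, rfl⟩
  · rw [toWeier_origin, origin, tau3_mk]
    exact toWeier_mk_zero _ _ (by simp [tangentForm])
  · rw [tau3_mk, toWeier_std]
    apply toWeier_mk_some
    · simp only [tangentForm, stdVec, Matrix.cons_val, hm]; grind
    · simp only [tangentForm, stdVec, Matrix.cons_val, hm]; field_simp;  grind

end HesseCurve

/-! ### Abelian groups with an endomorphism satisfying `T² = T - 1`. -/

theorem iterate_two_of_sextic {A : Type*} [AddCommGroup A] {T : A →+ A}
    (hT : ∀ x, T (T x) = T x - x) (x : A) : T^[2] x = T x - x := hT x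

theorem iterate_three_of_sextic {A : Type*} [AddCommGroup A] {T : A →+ A}
    (hT : ∀ x, T (T x) = T x - x) (x : A) : T^[3] x = -x := by
  change T (T (T x)) = -x
  rw [hT (T x), hT]
  abel

theorem iterate_four_of_sextic {A : Type*} [AddCommGroup A] {T : A →+ A}
    (hT : ∀ x, T (T x) = T x - x) (x : A) : T^[4] x = -T x :=
  iterate_three_of_sextic hT (T x)

theorem iterate_five_of_sextic {A : Type*} [AddCommGroup A] {T : A →+ A}
    (hT : ∀ x, T (T x) = T x - x) (x : A) : T^[5] x = x - T x := by
  change T^[3] (T (T x)) = _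
  rw [iterate_three_of_sextic hT, hT, neg_sub]

theorem injective_of_sextic {A : Type*} [AddCommGroup A] {T : A →+ A}
    (hT : ∀ x, T (T x) = T x - x) : Function.Injective T := by
  refine (injective_iff_map_eq_zero T).2 fun x hx => ?_
  have := hT x
  rw [hx, map_zero, zero_sub] at this
  exact neg_eq_zero.1 this.symm

/-- `1 - T = -T²`, and `T` is injective. -/
theorem torsion_sub_map_iff {A : Type*} [AddCommGroup A] {T : A →+ A}
    (hT : ∀ x, T (T x) = T x - x) (x : A) : 3 • (x - T x) = 0 ↔ 3 • x = 0 := by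
  have e : 3 • (x - T x) = -T (T (3 • x)) := by simp only [map_nsmul, hT]; module
  rw [e, neg_eq_zero, map_eq_zero_iff T (injective_of_sextic hT),
    map_eq_zero_iff T (injective_of_sextic hT)]

theorem torsion_sub_iterate_five_iff {A : Type*} [AddCommGroup A] {T : A →+ A}
    (hT : ∀ x, T (T x) = T x - x) (x : A) : 3 • (x - T^[5] x) = 0 ↔ 3 • x = 0 := by
  have e : 3 • (x - T^[5] x) = T (3 • x) := by
    rw [iterate_five_of_sextic hT, map_nsmul]; module
  rw [e, map_eq_zero_iff T (injective_of_sextic hT)]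

/-- `1 - T² = -T²(1 - T⁴)`, so the two operators have the same kernel after multiplication by 3. -/
theorem torsion_sub_iterate_four_iff {A : Type*} [AddCommGroup A] {T : A →+ A}
    (hT : ∀ x, T (T x) = T x - x) (x : A) :
    3 • (x - T^[4] x) = 0 ↔ 3 • (x - T^[2] x) = 0 := by
  have e : 3 • (x - T^[2] x) = -T (T (3 • (x - T^[4] x))) := by
    simp only [iterate_four_of_sextic hT, iterate_two_of_sextic hT, map_nsmul, map_sub, map_neg, hT]
    module
  rw [e, neg_eq_zero, map_eq_zero_iff T (injective_of_sextic hT),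
    map_eq_zero_iff T (injective_of_sextic hT)]

theorem fixed_iff_of_sextic {A : Type*} [AddCommGroup A] {T : A →+ A}
    (hT : ∀ x, T (T x) = T x - x) (x : A) : T^[2] x = x ↔ T x = 2 • x := by
  rw [iterate_two_of_sextic hT, sub_eq_iff_eq_add, two_nsmul]

/-- Because `1 - T² = 2 - T`, the condition says that `3x` lies in `ker (2 - T)`, the group of fixed
points of `T²`. -/
theorem torsion_sub_iterate_two_iff {A : Type*} [AddCommGroup A] {T : A →+ A}
    (hT : ∀ x, T (T x) = T x - x) (x : A) :
    3 • (x - T^[2] x) = 0 ↔ T (3 • x) = 2 • 3 • x := by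
  rw [iterate_two_of_sextic hT, map_nsmul]
  constructor <;> intro h
  · linear_combination (norm := module) -h
  · linear_combination (norm := module) -h

theorem three_nsmul_eq_zero_of_fixed {A : Type*} [AddCommGroup A] {T : A →+ A}
    (hT : ∀ x, T (T x) = T x - x) {x : A} (hx : T x = 2 • x) : 3 • x = 0 := by
  have h := hT x
  rw [hx, map_nsmul, hx] at h
  linear_combination (norm := module) h

/-- Let `π = 2 - T` and `K = ker π`; by `hK`, `K = {0, 3q, -3q}`. Both `3p` and `3q` lie in `K`, so
if `3p ≠ 0` then `3p = ±3q`, and `p ∓ q` is killed by 3, hence by `π²`. Thus `π(p ∓ q)` again has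
only three possible values in `K`. The sign and this value together select the exponent `l` for
which `p - Tˡq` lies in `K`. -/
theorem torsion_sub_iterate_two_iff_exists {A : Type*} [AddCommGroup A] {T : A →+ A}
    (hT : ∀ x, T (T x) = T x - x)
    (hK : ∀ x y, T^[2] x = x → T^[2] y = y → y ≠ 0 → x = 0 ∨ x = y ∨ x = -y)
    {q : A} (hq : 3 • (q - T^[2] q) = 0) (hq3 : 3 • q ≠ 0) (p : A) :
    3 • (p - T^[2] p) = 0 ↔ 3 • p = 0 ∨ ∃ l : Fin 6, ∃ r, T^[2] r = r ∧ p = T^[l] q + r := by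
  simp only [fixed_iff_of_sextic hT] at hK ⊢
  rw [torsion_sub_iterate_two_iff hT] at hq ⊢
  constructor
  · intro hp
    have hq' := hq
    rw [map_nsmul] at hq'
    rcases hK _ _ hp hq hq3 with h | h | h
    · exact .inl h
    · right
      -- This is `π²(p - q) = 3(1 - T)(p - q) = 0`.
      have hx : T (2 • (p - q) - T (p - q)) = 2 • (2 • (p - q) - T (p - q)) := by
        have h' := congrArg T h
        simp only [map_sub, map_nsmul, hT] at h' ⊢
        linear_combination (norm := module) h' - h
      -- `π(T²q - q) = -π²q = 3q`, and likewise `π(T⁴q - q) = -3q`. So the values `0, 3q, -3q` of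
      -- `π(p - q)` belong to `l = 0, 2, 4`.
      rcases hK _ _ hx hq hq3 with e | e | e <;> rw [map_sub] at e
      · refine ⟨0, p - q, ?_, ?_⟩
        · rw [map_sub]
          linear_combination (norm := module) -e
        · change p = q + (p - q)
          abel
      · refine ⟨2, p - T^[2] q, ?_, ?_⟩
        · rw [iterate_two_of_sextic hT, map_sub, map_sub, hT]
          linear_combination (norm := module) -e + hq'
        · change p = T^[2] q + _
          abel
      · refine ⟨4, p - T^[4] q, ?_, ?_⟩
        · rw [iterate_four_of_sextic hT, map_sub, map_neg, hT]
          linear_combination (norm := module) -e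
        · change p = T^[4] q + _
          abel
    · right
      have hx : T (2 • (p + q) - T (p + q)) = 2 • (2 • (p + q) - T (p + q)) := by
        have h' := congrArg T h
        simp only [map_sub, map_add, map_neg, map_nsmul, hT] at h' ⊢
        linear_combination (norm := module) h' - h
      -- The same with `-q = T³q` in place of `q`; now the exponents are odd.
      rcases hK _ _ hx hq hq3 with e | e | e <;> rw [map_add] at e
      · refine ⟨3, p - T^[3] q, ?_, ?_⟩
        · rw [iterate_three_of_sextic hT, map_sub, map_neg]
          linear_combination (norm := module) -e
        · change p = T^[3] q + _
          abel
      · refine ⟨1, p - T q, ?_, ?_⟩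
        · rw [map_sub, hT]
          linear_combination (norm := module) -e
        · change p = T q + _
          abel
      · refine ⟨5, p - T^[5] q, ?_, ?_⟩
        · rw [iterate_five_of_sextic hT, map_sub, map_sub, hT]
          linear_combination (norm := module) -e - hq'
        · change p = T^[5] q + _
          abel
  · rintro (h | ⟨l, r, hr, rfl⟩)
    · rw [h]; simp
    · have h3 := three_nsmul_eq_zero_of_fixed hT hr
      -- `3 Tˡq = Tˡ(3q)`, and `T` preserves `ker (2 - T)`.
      have e : T (3 • T^[l] q) = 2 • 3 • T^[l] q := by
        rw [← iterate_map_nsmul, ← Function.iterate_succ_apply' T, Function.iterate_succ_apply, hq,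
          iterate_map_nsmul]
      rw [nsmul_add, h3, add_zero, e]

theorem disjoint_orbit {A : Type*} [AddCommGroup A] {T : A →+ A}
    (hT : ∀ x, T (T x) = T x - x) {q r : A} (hq3 : 3 • q ≠ 0) (l : ℕ) (hr : T^[2] r = r) :
    3 • (T^[l] q + r) ≠ 0 := by
  rw [nsmul_add, three_nsmul_eq_zero_of_fixed hT ((fixed_iff_of_sextic hT r).1 hr), add_zero,
    ← iterate_map_nsmul]
  intro h
  rw [← iterate_map_zero T l] at h
  exact hq3 ((injective_of_sextic hT).iterate l h)

/-- Makes the cosets of the `Tˡq` modulo the fixed points of `T²` distinct. With `π = 2 - T`, the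
operator `Tʲ - 1` is a unit for `j = 1, 5`, an associate of `π` for `j = 2, 4`, and `-2` for `j =
3`. If `Tʲq - q` were in `ker π`, then `πq`, `π²q` or `2πq` would vanish. Each possibility gives `3q
= 0`, the last one because `6q = 0` and `9q = 0`. -/
theorem iterate_sub_not_fixed {A : Type*} [AddCommGroup A] {T : A →+ A}
    (hT : ∀ x, T (T x) = T x - x) {q : A} (hq : 3 • (q - T^[2] q) = 0) (hq3 : 3 • q ≠ 0)
    {j : ℕ} (hj : 0 < j) (hj6 : j < 6) : T^[2] (T^[j] q - q) ≠ T^[j] q - q := by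
  rw [Ne, fixed_iff_of_sextic hT]
  intro h
  have h9 := three_nsmul_eq_zero_of_fixed hT ((torsion_sub_iterate_two_iff hT q).1 hq)
  apply hq3
  have h' := congrArg T h
  interval_cases j
  · change T (T q - q) = 2 • (T q - q) at h
    change T (T (T q - q)) = T (2 • (T q - q)) at h'
    simp only [map_sub, map_nsmul, hT] at h h'
    linear_combination (norm := module) 2 • h' - h
  · rw [iterate_two_of_sextic hT] at h h'
    simp only [map_sub, map_nsmul, hT] at h h'
    linear_combination (norm := module) h'
  · rw [iterate_three_of_sextic hT] at h h'
    simp only [map_sub, map_nsmul, map_neg, hT] at h h'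
    linear_combination (norm := module) h9 - h - h'
  · rw [iterate_four_of_sextic hT] at h h'
    simp only [map_sub, map_nsmul, map_neg, hT] at h h'
    linear_combination (norm := module) h
  · rw [iterate_five_of_sextic hT] at h h'
    simp only [map_sub, map_nsmul, hT] at h h'
    linear_combination (norm := module) 2 • h - h'

theorem ncard_orbit {A : Type*} [AddCommGroup A] {T : A →+ A} (hT : ∀ x, T (T x) = T x - x)
    (hK : ∀ x y, T^[2] x = x → T^[2] y = y → y ≠ 0 → x = 0 ∨ x = y ∨ x = -y)
    {q : A} (hq : 3 • (q - T^[2] q) = 0) (hq3 : 3 • q ≠ 0) :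
    {p | ∃ l : Fin 6, ∃ r, T^[2] r = r ∧ p = T^[l] q + r}.ncard = 18 := by
  have hfix : ∀ n : ℕ, T^[2] (n • 3 • q) = n • 3 • q := by
    intro n
    rw [iterate_map_nsmul, (fixed_iff_of_sextic hT _).2 ((torsion_sub_iterate_two_iff hT q).1 hq)]
  have h9 : 3 • 3 • q = 0 :=
    three_nsmul_eq_zero_of_fixed hT ((torsion_sub_iterate_two_iff hT q).1 hq)
  -- The fixed points of `T²` are the multiples `0, 3q, 6q`, where `6q = -3q`; this turns the set
  -- into the image of a product of 6 by 3 indices.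
  have heq : {p | ∃ l : Fin 6, ∃ r, T^[2] r = r ∧ p = T^[l] q + r} =
      Set.range fun a : Fin 6 × Fin 3 => T^[a.1] q + (a.2 : ℕ) • 3 • q := by
    ext p
    constructor
    · rintro ⟨l, r, hr, rfl⟩
      have h1 := hfix 1
      rw [one_nsmul] at h1
      rcases hK r _ hr h1 hq3 with rfl | rfl | rfl
      · exact ⟨(l, 0), by simp⟩
      · exact ⟨(l, 1), by simp⟩
      · refine ⟨(l, 2), congrArg (T^[l] q + ·) ?_⟩
        change 2 • 3 • q = -(3 • q)
        linear_combination (norm := module) h9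
    · rintro ⟨⟨l, n⟩, rfl⟩
      exact ⟨l, _, hfix n, rfl⟩
  -- An equality would make `Tˡ(Tᵐ⁻ˡq - q) = r - r'` fixed by `T²`; injectivity of `Tˡ` carries this
  -- back to `Tᵐ⁻ˡq - q`.
  have hlt : ∀ (l m : Fin 6) (r r' : A), T^[2] r = r → T^[2] r' = r' → l < m →
      T^[l] q + r ≠ T^[m] q + r' := by
    intro l m r r' hr hr' hlm h
    refine iterate_sub_not_fixed hT hq hq3 (j := m - l) (by omega) (by omega) ?_
    apply (injective_of_sextic hT).iterate l
    rw [← Function.iterate_add_apply, add_comm, Function.iterate_add_apply, iterate_map_sub,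
      ← Function.iterate_add_apply, Nat.add_sub_cancel' hlm.le,
      show T^[m] q - T^[l] q = r - r' by rw [sub_eq_sub_iff_add_eq_add, ← h, add_comm],
      iterate_map_sub, hr, hr']
  have hinj : Function.Injective fun a : Fin 6 × Fin 3 => T^[a.1] q + (a.2 : ℕ) • 3 • q := by
    rintro ⟨l, n⟩ ⟨m, n'⟩ h
    rcases lt_trichotomy l m with hlm | rfl | hlm
    · exact absurd h (hlt l m _ _ (hfix n) (hfix n') hlm)
    · have h' : (n : ℕ) • 3 • q = (n' : ℕ) • 3 • q := add_left_cancel h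
      have ho : addOrderOf (3 • q) = 3 := addOrderOf_eq_prime h9 hq3
      have := (nsmul_inj_mod (x := 3 • q)).1 h'
      rw [ho, Nat.mod_eq_of_lt n.2, Nat.mod_eq_of_lt n'.2] at this
      rw [Fin.ext this]
    · exact absurd h.symm (hlt m l _ _ (hfix n') (hfix n) hlm)
  rw [heq, ← Set.image_univ, Set.ncard_image_of_injective _ hinj, Set.ncard_univ]
  simp

/-- `(1 - T²)² = 3(1 - T)` is 3 up to a unit. This tests 3-torsion by a fixed point condition, which
on the curve is the vanishing of one coordinate, and so avoids computing `3x`. -/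
theorem three_nsmul_eq_zero_iff_fixed {A : Type*} [AddCommGroup A] {T : A →+ A}
    (hT : ∀ x, T (T x) = T x - x) (x : A) :
    3 • x = 0 ↔ T^[2] (x - T^[2] x) = x - T^[2] x := by
  rw [fixed_iff_of_sextic hT, iterate_two_of_sextic hT, ← torsion_sub_map_iff hT]
  simp only [map_sub, hT]
  constructor <;> intro h
  · linear_combination (norm := module) -h
  · linear_combination (norm := module) -h

/-! ### Abelian groups with an endomorphism satisfying `T² = -1`. -/

/-- If `3x` is fixed by `T`, then `3x = T²(3x) = -3x`, so `6x = 0`. In `x = 3x + (-2x)` the first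
term is `0` or `b` and the second is killed by 3. -/
theorem torsion_sub_iff_of_quartic {A : Type*} [AddCommGroup A] {T : A →+ A}
    (hT : ∀ x, T (T x) = -x) {b : A} (hb : T b = b) (hfix : ∀ x, T x = x → x = 0 ∨ x = b) (x : A) :
    3 • (x - T x) = 0 ↔ x ∈ AddSubgroup.zmultiples b ⊔ AddSubgroup.torsionBy A 3 := by
  constructor
  · intro h
    have h1 : T (3 • x) = 3 • x := by
      rw [map_nsmul]
      linear_combination (norm := module) -h
    have h2 : (3 • x : A) = -(3 • x : A) := by rw [← hT (3 • x), h1, h1]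
    have h3 : 3 • x ∈ AddSubgroup.zmultiples b := by
      rcases hfix _ h1 with e | e <;> rw [e]
      · exact zero_mem _
      · exact AddSubgroup.mem_zmultiples b
    have h4 : -(2 • x) ∈ AddSubgroup.torsionBy A 3 := by
      change (3 : ℤ) • -(2 • x) = 0
      linear_combination (norm := module) -h2
    exact AddSubgroup.mem_sup.2 ⟨_, h3, _, h4, by module⟩
  · intro h
    obtain ⟨_, ⟨n, rfl⟩, z, hz, rfl⟩ := AddSubgroup.mem_sup.1 h
    have hz' : 3 • z = 0 := by
      change (3 : ℤ) • z = 0 at hz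
      exact_mod_cast hz
    have hz2 := congrArg T hz'
    simp only [map_nsmul, map_zero] at hz2
    simp only [map_add, map_zsmul, hb]
    linear_combination (norm := module) hz' - hz2

/-- `T` exchanges the two operators up to sign: `T(1 + T) = -(1 - T)` and `T(1 - T) = 1 + T`. This
reduces `T³ = -T` to `T`. -/
theorem torsion_add_iff_of_quartic {A : Type*} [AddCommGroup A] {T : A →+ A}
    (hT : ∀ x, T (T x) = -x) (x : A) : 3 • (x + T x) = 0 ↔ 3 • (x - T x) = 0 := by
  constructor <;> intro h <;> have h' := congrArg T h <;>
    simp only [map_nsmul, map_zero, map_add, map_sub, hT] at h'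
  · linear_combination (norm := module) -h'
  · linear_combination (norm := module) h'

/-! ### The sets `U_τ` and points of the Hesse cubic in coordinates. -/

namespace HesseCurve

theorem mem_USet_iff {k : Type*} [Field k] [CharZero k] {lam : k} {h : lam ^ 3 ≠ 1}
    (τ : HesseCurve lam h → HesseCurve lam h) (P : HesseCurve lam h) :
    P ∈ USet τ ↔ 3 • (P - τ P) = 0 := by
  change (3 : ℤ) • (P - τ P) = 0 ↔ _
  norm_cast

theorem USet_id {k : Type*} [Field k] [CharZero k] {lam : k} {h : lam ^ 3 ≠ 1} :
    USet (id : HesseCurve lam h → HesseCurve lam h) = Set.univ := by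
  ext P
  simp [mem_USet_iff]

theorem USet_neg {k : Type*} [Field k] [CharZero k] {lam : k} {h : lam ^ 3 ≠ 1}
    {τ : HesseCurve lam h → HesseCurve lam h} (hτ : ∀ P, τ P = -P) :
    USet τ = AddSubgroup.torsionBy (HesseCurve lam h) 6 := by
  ext P
  rw [mem_USet_iff, hτ]
  change _ ↔ (6 : ℤ) • P = 0
  rw [show (3 • (P - -P) : HesseCurve lam h) = (6 : ℤ) • P by module]

theorem exists_mk {k : Type*} [Field k] {lam : k} {h : lam ^ 3 ≠ 1} (P : HesseCurve lam h) :
    ∃ v hv hF, P = mk v hv hF := ⟨_, _, _, (mk_rep P).symm⟩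

theorem exists_smul_of_mk_eq_mk {k : Type*} [Field k] {lam : k} {h : lam ^ 3 ≠ 1} {v w : Fin 3 → k}
    {hv : v ≠ 0} {hw : w ≠ 0} {hFv : hesseForm lam v = 0} {hFw : hesseForm lam w = 0}
    (e : mk (h := h) v hv hFv = mk w hw hFw) : ∃ t : k, t • w = v :=
  (Projectivization.mk_eq_mk_iff' k v w hv hw).1 (congrArg Subtype.val e)

theorem mk_eq_zero {k : Type*} [Field k] [CharZero k] {lam : k} {h : lam ^ 3 ≠ 1} {v : Fin 3 → k}
    (hv : v ≠ 0) (hF : hesseForm lam v = 0) (h2 : v 2 = 0) (h01 : v 0 + v 1 = 0) :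
    (mk v hv hF : HesseCurve lam h) = 0 := by
  refine mk_eq_mk (hFw := by simp [hesseForm]; ring) (v 0) ?_
  ext i
  fin_cases i
  · simp
  · simp; linear_combination -h01
  · simp [h2]

/-- The additive endomorphism `τ₂` of the Hesse cubic with `λ = 0`. -/
noncomputable def tau2Hom {k : Type*} [Field k] [CharZero k] {ε : k} (hε : IsPrimitiveRoot ε 3) :
    HesseCurve (0 : k) zero_cube_ne_one →+ HesseCurve (0 : k) zero_cube_ne_one :=
  AddMonoidHom.mk' (tau2 hε) (tau2_add hε)

/-- The additive endomorphism `τ₃` of the Hesse cubic with `λ = 1 + √3`. -/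
noncomputable def tau3Hom {k : Type*} [Field k] [CharZero k] {s ε : k} (hs : s ^ 2 = 3)
    (hε : IsPrimitiveRoot ε 3) : HesseCurve (1 + s) (one_add_sqrt_cube_ne_one hs) →+
      HesseCurve (1 + s) (one_add_sqrt_cube_ne_one hs) :=
  AddMonoidHom.mk' (tau3 hs hε) (tau3_add hs hε)

/-! ### The square and the fixed points of `τ₃`. -/

theorem tau3_tau3 {k : Type*} [Field k] [CharZero k] {s ε : k} (hs : s ^ 2 = 3)
    (hε : IsPrimitiveRoot ε 3) (P : HesseCurve (1 + s) (one_add_sqrt_cube_ne_one hs)) :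
    tau3 hs hε (tau3 hs hε P) = -P := by
  obtain ⟨v, hv, hF, rfl⟩ := exists_mk P
  change _ = tau1 _
  rw [tau3_mk, tau3_mk, tau1_mk]
  have h1 := sum_primitive_cube hε
  have h3 := hε.pow_eq_one
  -- The matrix of `τ₃` is of discrete Fourier type; its square is 3 times the swap of the first two
  -- coordinates.
  refine mk_eq_mk 3 ?_
  ext i
  fin_cases i <;> simp <;> grind

theorem tau3_pointB {k : Type*} [Field k] [CharZero k] {s ε : k} (hs : s ^ 2 = 3)
    (hε : IsPrimitiveRoot ε 3) : tau3 hs hε (pointB hs) = pointB hs := by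
  rw [pointB, tau3_mk]
  have h1 := sum_primitive_cube hε
  refine mk_eq_mk s ?_
  ext i
  fin_cases i <;> simp <;> grind

/-- A fixed point satisfies `P = τ₃²(P) = -P`, so unless `z = 0`, which gives the origin, it has the
form `(a : a : c)`. Fixedness then leaves `c = (1 ± s) a`, and the cubic excludes the minus sign. -/
theorem eq_zero_or_eq_pointB_of_tau3_eq {k : Type*} [Field k] [CharZero k] {s ε : k}
    (hs : s ^ 2 = 3) (hε : IsPrimitiveRoot ε 3)
    (P : HesseCurve (1 + s) (one_add_sqrt_cube_ne_one hs)) (hP : tau3 hs hε P = P) :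
    P = 0 ∨ P = pointB hs := by
  have hneg : tau1 P = P := by
    change -P = P
    rw [← tau3_tau3 hs hε, hP, hP]
  have h1 := sum_primitive_cube hε
  obtain ⟨v, hv, hF, rfl⟩ := exists_mk P
  rw [tau3_mk] at hP
  rw [tau1_mk] at hneg
  obtain ⟨t, ht⟩ := exists_smul_of_mk_eq_mk hP
  obtain ⟨u, hu⟩ := exists_smul_of_mk_eq_mk hneg
  have hv' := vec_ne_zero hv
  have ht0 := congrFun ht 0
  have ht1 := congrFun ht 1
  have ht2 := congrFun ht 2
  have hu0 := congrFun hu 0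
  have hu1 := congrFun hu 1
  have hu2 := congrFun hu 2
  simp only [Pi.smul_apply, smul_eq_mul, Matrix.cons_val] at ht0 ht1 ht2 hu0 hu1 hu2
  by_cases h2 : v 2 = 0
  · left
    refine mk_eq_zero hv hF h2 ?_
    have h01 : v 0 + v 1 = 0 := by
      rw [h2] at ht2
      by_contra hne
      have : v 0 = v 1 := by
        have : (v 0 + v 1) * (v 0 - v 1) = 0 := by linear_combination v 1 * hu0 - v 0 * hu1
        simpa [hne, sub_eq_zero] using this
      simp only [hesseForm, h2, this] at hF
      have : v 1 = 0 := by
        have : 2 * v 1 ^ 3 = 0 := by linear_combination hF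
        simpa using this
      simp_all
    exact h01
  · right
    have hu' : u = 1 := by
      have : (u - 1) * v 2 = 0 := by linear_combination hu2
      simpa [h2, sub_eq_zero] using this
    rw [hu', one_mul] at hu0
    refine mk_eq_mk (v 0) ?_
    simp only [hesseForm] at hF
    rw [← hu0] at hF ht0 ht2
    have hv0 : v 0 ≠ 0 := by
      intro h0
      rw [h0] at hF
      exact h2 (by simpa using hF)
    have e1 : v 2 ^ 2 = 2 * v 0 ^ 2 + 2 * v 0 * v 2 := by
      have e : t * v 0 * v 2 = t * v 2 * v 0 := by ring
      rw [ht0, ht2] at e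
      linear_combination e - h1 * v 0 * v 2
    have e2 : (v 2 - (1 + s) * v 0) * (v 2 - (1 - s) * v 0) = 0 := by
      linear_combination e1 - v 0 ^ 2 * hs
    rcases mul_eq_zero.1 e2 with e | e
    · ext i
      fin_cases i
      · simp
      · simpa using hu0
      · simp; linear_combination -e
    · exfalso
      have ec : v 2 = (1 - s) * v 0 := by linear_combination e
      rw [ec] at hF
      -- The cubic form at `(1, 1, 1 - s)` equals `18 - 6s`; its vanishing would give `s = 3`,
      -- against `s² = 3`.
      have : v 0 ^ 3 * (18 - 6 * s) = 0 := by grind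
      have : 18 - 6 * s = 0 := by simpa [hv0] using this
      grind

/-! ### The quadratic relation and the fixed points for `τ₂`, and the point `q`. -/

theorem tau2_tau2 {k : Type*} [Field k] [CharZero k] {ε : k} (hε : IsPrimitiveRoot ε 3)
    (P : HesseCurve (0 : k) zero_cube_ne_one) : tau2 hε (tau2 hε P) = tau2 hε P - P := by
  rw [eq_sub_iff_add_eq, add_comm]
  obtain ⟨v, hv, hF, rfl⟩ := exists_mk P
  change add _ _ = _
  have h3 := hε.pow_eq_one
  have hε1 : ε ^ 2 ≠ 1 := hε.pow_ne_one_of_pos_of_lt (by norm_num) (by norm_num)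
  rw [tau2_mk, tau2_mk]
  simp only [Matrix.cons_val]
  -- The relation is checked as `P + τ₂²(P) = τ₂(P)`. The first formula gives `τ₂(P)` times `abc(1 -
  -- ε²)`; it degenerates exactly when some coordinate is zero, and there the second formula takes
  -- over.
  have hFst : hesseAddFst v ![v 0, v 1, v 2 * ε * ε] =
      (v 0 * v 1 * v 2 * (1 - ε ^ 2)) • ![v 1, v 0, v 2 * ε] := by
    ext i
    fin_cases i
    · simp [hesseAddFst]; ring
    · simp [hesseAddFst]; ring
    · simp [hesseAddFst]; linear_combination v 0 * v 1 * v 2 ^ 2 * (ε + 1) * h3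
  by_cases hv0 : hesseAddFst v ![v 0, v 1, v 2 * ε * ε] = 0
  · rw [add_mk_snd _ _ _ _ hv0]
    rw [hFst, smul_eq_zero, or_iff_left (tau2_ne_zero hε hv)] at hv0
    have habc : (v 0 = 0 ∨ v 1 = 0) ∨ v 2 = 0 := by
      simpa [sub_eq_zero, hε1.symm] using hv0
    simp only [hesseForm] at hF
    rcases habc with (h0 | h0) | h0
    · refine mk_eq_mk (-v 2 ^ 3 * ε ^ 2) ?_
      rw [h0] at hF
      ext i
      fin_cases i
      · simp [hesseAddSnd, h0]; ring
      · simp [hesseAddSnd, h0]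
      · simp [hesseAddSnd, h0]; linear_combination -v 2 * hF - v 2 ^ 4 * h3
    · refine mk_eq_mk (v 2 ^ 3 * ε) ?_
      rw [h0] at hF
      ext i
      fin_cases i
      · simp [hesseAddSnd, h0]
      · simp [hesseAddSnd, h0]; linear_combination -v 2 ^ 3 * v 0 * ε * h3
      · simp [hesseAddSnd, h0]; linear_combination v 2 * ε ^ 2 * hF
    · refine mk_eq_mk (v 0 ^ 3) ?_
      rw [h0] at hF
      ext i
      fin_cases i
      · simp [hesseAddSnd, h0]; ring
      · simp [hesseAddSnd, h0]; linear_combination v 0 * hF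
      · simp [hesseAddSnd, h0]
  · rw [add_mk_fst _ _ _ _ hv0]
    exact mk_eq_mk _ hFst.symm

/-- `τ₂²` multiplies only the third coordinate, by `ε² ≠ 1`; the other projective fixed point `(0 :
0 : 1)` is not on the cubic. -/
theorem tau2_iterate_two_mk_iff {k : Type*} [Field k] [CharZero k] {ε : k}
    (hε : IsPrimitiveRoot ε 3) {v : Fin 3 → k} (hv : v ≠ 0) (hF : hesseForm 0 v = 0) :
    (tau2 hε)^[2] (mk v hv hF) = mk v hv hF ↔ v 2 = 0 := by
  change tau2 hε (tau2 hε _) = _ ↔ _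
  have hε1 : ε ≠ 1 := hε.ne_one (by norm_num)
  have h3 := hε.pow_eq_one
  rw [tau2_mk, tau2_mk]
  constructor
  · intro h
    obtain ⟨t, ht⟩ := exists_smul_of_mk_eq_mk h
    have h0 := congrFun ht 0
    have h1 := congrFun ht 1
    have h2 := congrFun ht 2
    simp only [Pi.smul_apply, smul_eq_mul, Matrix.cons_val] at h0 h1 h2
    by_contra hc
    have ht : t = ε ^ 2 := mul_right_cancel₀ hc (by linear_combination h2)
    have ht1 : t ≠ 1 := by
      rintro rfl
      apply hε1
      linear_combination h3 + ε * ht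
    have h0' : v 0 = 0 := by
      have : (t - 1) * v 0 = 0 := by linear_combination h0
      simpa [sub_eq_zero, ht1] using this
    have h1' : v 1 = 0 := by
      have : (t - 1) * v 1 = 0 := by linear_combination h1
      simpa [sub_eq_zero, ht1] using this
    simp [hesseForm, h0', h1'] at hF
    exact hc hF
  · intro h
    refine mk_eq_mk 1 ?_
    ext i
    fin_cases i <;> simp [h]

theorem fixed_tau2_iterate_two {k : Type*} [Field k] [CharZero k] {ε : k}
    (hε : IsPrimitiveRoot ε 3) (P Q : HesseCurve (0 : k) zero_cube_ne_one)
    (hP : (tau2 hε)^[2] P = P) (hQ : (tau2 hε)^[2] Q = Q) (hQ0 : Q ≠ 0) :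
    P = 0 ∨ P = Q ∨ P = -Q := by
  obtain ⟨v, hv, hF, rfl⟩ := exists_mk P
  obtain ⟨w, hw, hG, rfl⟩ := exists_mk Q
  rw [tau2_iterate_two_mk_iff] at hP hQ
  change _ ∨ _ ∨ _ = tau1 _
  rw [tau1_mk]
  have hv' := vec_ne_zero hv
  have hw' := vec_ne_zero hw
  simp only [hesseForm, hP, hQ] at hF hG
  have hv1 : v 1 ≠ 0 := by
    intro h
    rw [h] at hF
    simp at hF
    exact hv' ⟨hF, h, hP⟩
  have hw1 : w 1 ≠ 0 := by
    intro h
    rw [h] at hG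
    simp at hG
    exact hw' ⟨hG, h, hQ⟩
  have hw0 : w 0 ≠ 0 := by
    intro h
    rw [h] at hG
    simp at hG
    exact hw1 hG
  have hs : w 0 + w 1 ≠ 0 := by
    intro h
    exact hQ0 (mk_eq_zero hw _ hQ h)
  have e : w 0 ^ 2 - w 0 * w 1 + w 1 ^ 2 = 0 := by
    have : (w 0 + w 1) * (w 0 ^ 2 - w 0 * w 1 + w 1 ^ 2) = 0 := by linear_combination hG
    simpa [hs] using this
  -- When `z = 0` the equation is `a³ + b³ = 0`. With `w` a root of the quadratic factor, the
  -- product of the last two factors is `w₀w₁(v₀² - v₀v₁ + v₁²)`, so the three factors mean `P = 0`,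
  -- `P = Q`, `P = -Q`.
  have key : (v 0 + v 1) * ((v 0 * w 1 - v 1 * w 0) * (v 0 * w 0 - v 1 * w 1)) = 0 := by
    grind
  rcases mul_eq_zero.1 key with h | h
  · left
    exact mk_eq_zero hv _ hP h
  · right
    rcases mul_eq_zero.1 h with h | h
    · left
      refine mk_eq_mk (v 1 / w 1) ?_
      ext i
      fin_cases i
      · simp; field_simp; linear_combination -h
      · simp; field_simp
      · simp [hP, hQ]
    · right
      refine mk_eq_mk (v 1 / w 0) ?_
      ext i
      fin_cases i
      · simp; field_simp; linear_combination -h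
      · simp; field_simp
      · simp [hP, hQ]

theorem mk_sub_tau2_iterate_two {k : Type*} [Field k] [CharZero k] {ε : k}
    (hε : IsPrimitiveRoot ε 3) {v : Fin 3 → k} (hv : v ≠ 0) (hF : hesseForm 0 v = 0)
    (hv2 : v 2 ≠ 0) :
    ∃ hw hG, (mk v hv hF : HesseCurve (0 : k) zero_cube_ne_one) - (tau2 hε)^[2] (mk v hv hF) =
      mk ![v 0 ^ 3 - ε ^ 2 * v 1 ^ 3, v 1 ^ 3 - ε ^ 2 * v 0 ^ 3, v 0 * v 1 * v 2 * (ε - 1)]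
        hw hG := by
  have h3 := hε.pow_eq_one
  have hε1 : ε ≠ 1 := hε.ne_one (by norm_num)
  have hFst : hesseAddFst v ![v 1, v 0, v 2 * ε * ε] = v 2 • ![v 0 ^ 3 - ε ^ 2 * v 1 ^ 3,
      v 1 ^ 3 - ε ^ 2 * v 0 ^ 3, v 0 * v 1 * v 2 * (ε - 1)] := by
    ext i
    fin_cases i
    · simp [hesseAddFst]; ring
    · simp [hesseAddFst]; ring
    · simp [hesseAddFst]; linear_combination v 0 * v 1 * v 2 ^ 2 * ε * h3
  have hw : ![v 0 ^ 3 - ε ^ 2 * v 1 ^ 3, v 1 ^ 3 - ε ^ 2 * v 0 ^ 3,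
      v 0 * v 1 * v 2 * (ε - 1)] ≠ 0 := by
    intro h
    have e0 := congrFun h 0
    have e1 := congrFun h 1
    simp only [Matrix.cons_val, Pi.zero_apply] at e0 e1
    have hb : (ε - 1) * v 1 ^ 3 = 0 := by linear_combination -e1 - ε ^ 2 * e0 - ε * v 1 ^ 3 * h3
    have hb : v 1 = 0 := by simpa [sub_eq_zero, hε1] using hb
    have ha : v 0 = 0 := by simpa [hb] using e0
    simp only [hesseForm, ha, hb] at hF
    exact hv2 (by simpa using hF)
  have hne : hesseAddFst v ![v 1, v 0, v 2 * ε * ε] ≠ 0 := by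
    rw [hFst]
    exact smul_ne_zero hv2 hw
  have hG' := form_addFst hF (form_swap (form_tau2 hε (form_tau2 hε hF)))
  simp only [Matrix.cons_val] at hG'
  have hG := hG'
  rw [hFst, form_smul] at hG
  refine ⟨hw, by simpa [hv2] using hG, ?_⟩
  rw [sub_eq_add_neg]
  change add _ (tau1 (tau2 hε (tau2 hε _))) = _
  rw [tau2_mk, tau2_mk, tau1_mk]
  simp only [Matrix.cons_val]
  rw [add_mk_fst _ _ _ _ hne]
  exact mk_eq_mk _ hFst.symm

/-- By `three_nsmul_eq_zero_iff_fixed`, both claims concern third coordinates. That of `q - τ₂²(q)`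
is `η¹²(ε - 1) ≠ 0`, so `q` is not 3-torsion. Applying `1 - τ₂²` once more gives a third coordinate
with the first two coordinates of `q - τ₂²(q)` as factors, and one of these is zero. -/
theorem pointQ_not_torsion {k : Type*} [Field k] [CharZero k] {ε η : k}
    (hε : IsPrimitiveRoot ε 3) (hη : IsPrimitiveRoot η 9) :
    3 • (pointQ hη - (tau2 hε)^[2] (pointQ hη)) = 0 ∧ 3 • pointQ hη ≠ 0 := by
  have hT : ∀ x, tau2Hom hε (tau2Hom hε x) = tau2Hom hε x - x := tau2_tau2 hε
  have key : ∀ x, 3 • x = 0 ↔ (tau2 hε)^[2] (x - (tau2 hε)^[2] x) = x - (tau2 hε)^[2] x :=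
    three_nsmul_eq_zero_iff_fixed hT
  have hε1 : ε ≠ 1 := hε.ne_one (by norm_num)
  have hη0 : η ≠ 0 := hη.ne_zero (by norm_num)
  have h3 := hε.pow_eq_one
  have h9 := hη.pow_eq_one
  have hηε : η ^ 3 = ε ∨ η ^ 3 = ε ^ 2 := by
    have hη3 : IsPrimitiveRoot (η ^ 3) 3 := hη.pow (by norm_num) (by norm_num)
    have e1 := sum_primitive_cube hε
    have e2 := sum_primitive_cube hη3
    have : (η ^ 3 - ε) * (η ^ 3 - ε ^ 2) = 0 := by
      linear_combination e2 - η ^ 3 * e1 + h3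
    simpa [sub_eq_zero] using this
  obtain ⟨hw, hG, e⟩ := mk_sub_tau2_iterate_two hε (vec_third_ne_zero one_ne_zero)
    (form_pointQ hη) (by simp)
  change pointQ hη - (tau2 hε)^[2] (pointQ hη) = _ at e
  rw [Ne, key, key (pointQ hη), e, tau2_iterate_two_mk_iff]
  simp only [Matrix.cons_val] at hw hG e ⊢
  constructor
  · obtain ⟨hw', hG', e'⟩ := mk_sub_tau2_iterate_two hε hw hG
      (by simp [hη0, sub_eq_zero, hε1])
    rw [e', tau2_iterate_two_mk_iff]
    simp only [Matrix.cons_val]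
    -- Which coordinate vanishes depends on the cube root of unity `η³`: the second if `η³ = ε`, the
    -- first if `η³ = ε²`.
    rcases hηε with h | h
    · have : (η ^ 4) ^ 3 - ε ^ 2 * (η ^ 8) ^ 3 = 0 := by
        rw [show (η ^ 4) ^ 3 = (η ^ 3) ^ 4 by ring, show (η ^ 8) ^ 3 = (η ^ 3) ^ 8 by ring, h]
        linear_combination (ε - ε ^ 7 - ε ^ 4 - ε) * h3
      rw [this]
      ring
    · have : (η ^ 8) ^ 3 - ε ^ 2 * (η ^ 4) ^ 3 = 0 := by
        rw [show (η ^ 4) ^ 3 = (η ^ 3) ^ 4 by ring, show (η ^ 8) ^ 3 = (η ^ 3) ^ 8 by ring, h]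
        grind
      rw [this]
      ring
  · simp [hη0, sub_eq_zero, hε1]

end HesseCurve

/-! ### The three cases assembled. -/

open HesseCurve in
theorem theorem3 {k : Type*} [Field k] [IsAlgClosed k] [CharZero k] :
    (∀ (lam : k) (h : lam ^ 3 ≠ 1), hesseJ lam ≠ 0 → hesseJ lam ≠ 12 ^ 3 →
      USet (tau1 (h := h))^[0] = Set.univ ∧
      USet (tau1 (h := h))^[1] = AddSubgroup.torsionBy (HesseCurve lam h) 6) ∧
    (∀ (ε η : k) (hε : IsPrimitiveRoot ε 3) (hη : IsPrimitiveRoot η 9),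
      USet (tau2 hε)^[0] = Set.univ ∧
      (∀ i : ℕ, i = 1 ∨ i = 5 → USet (tau2 hε)^[i] =
        AddSubgroup.torsionBy (HesseCurve (0 : k) zero_cube_ne_one) 3) ∧
      (∀ i : ℕ, i = 2 ∨ i = 4 → USet (tau2 hε)^[i] =
        (AddSubgroup.torsionBy (HesseCurve (0 : k) zero_cube_ne_one) 3 : Set _) ∪
          orbitQ hε hη) ∧
      Disjoint (AddSubgroup.torsionBy (HesseCurve (0 : k) zero_cube_ne_one) 3 : Set _)
        (orbitQ hε hη) ∧
      (orbitQ hε hη).ncard = 18 ∧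
      USet (tau2 hε)^[3] = AddSubgroup.torsionBy (HesseCurve (0 : k) zero_cube_ne_one) 6) ∧
    (∀ (s ε : k) (hs : s ^ 2 = 3) (hε : IsPrimitiveRoot ε 3),
      USet (tau3 hs hε)^[0] = Set.univ ∧
      (∀ i : ℕ, i = 1 ∨ i = 3 → USet (tau3 hs hε)^[i] =
        ((AddSubgroup.zmultiples (pointB hs) ⊔
          AddSubgroup.torsionBy (HesseCurve (1 + s) (one_add_sqrt_cube_ne_one hs)) 3 :
            AddSubgroup _) : Set _)) ∧
      Disjoint (AddSubgroup.zmultiples (pointB hs))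
        (AddSubgroup.torsionBy (HesseCurve (1 + s) (one_add_sqrt_cube_ne_one hs)) 3) ∧
      USet (tau3 hs hε)^[2] =
        AddSubgroup.torsionBy (HesseCurve (1 + s) (one_add_sqrt_cube_ne_one hs)) 6) := by
  refine ⟨fun lam h _ _ => ⟨USet_id, USet_neg fun P => rfl⟩, fun ε η hε hη => ?_,
    fun s ε hs hε => ?_⟩
  · have hT : ∀ x, tau2Hom hε (tau2Hom hε x) = tau2Hom hε x - x := tau2_tau2 hε
    have hK : ∀ x y, (tau2Hom hε)^[2] x = x → (tau2Hom hε)^[2] y = y → y ≠ 0 →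
      x = 0 ∨ x = y ∨ x = -y := fixed_tau2_iterate_two hε
    obtain ⟨hq, hq3⟩ := pointQ_not_torsion hε hη
    have htors : ∀ P, P ∈ AddSubgroup.torsionBy (HesseCurve (0 : k) zero_cube_ne_one) 3 ↔
        3 • P = 0 := by
      intro P
      change (3 : ℤ) • P = 0 ↔ _
      norm_cast
    have htwo : ∀ P, 3 • (P - (tau2 hε)^[2] P) = 0 ↔ 3 • P = 0 ∨ P ∈ orbitQ hε hη :=
      torsion_sub_iterate_two_iff_exists hT hK hq hq3
    refine ⟨USet_id, ?_, ?_, ?_, ncard_orbit hT hK hq hq3,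
      USet_neg (iterate_three_of_sextic hT)⟩
    · rintro i (rfl | rfl) <;> ext P <;> rw [mem_USet_iff, SetLike.mem_coe, htors]
      · exact torsion_sub_map_iff hT P
      · exact torsion_sub_iterate_five_iff hT P
    · rintro i (rfl | rfl) <;> ext P <;>
        rw [mem_USet_iff, Set.mem_union, SetLike.mem_coe, htors, ← htwo]
      exact torsion_sub_iterate_four_iff hT P
    · rw [Set.disjoint_left]
      rintro P hP ⟨l, r, hr, rfl⟩
      exact disjoint_orbit hT hq3 l hr ((htors _).1 hP)
  · have hT : ∀ x, tau3Hom hs hε (tau3Hom hs hε x) = -x := tau3_tau3 hs hε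
    -- The point is fixed by `τ₃` and `τ₃² = -1`, so it has order dividing 2; this makes its
    -- multiples meet the 3-torsion trivially.
    have hB : -pointB hs = pointB hs := by
      rw [← tau3_tau3 hs hε, tau3_pointB, tau3_pointB]
    have hone := torsion_sub_iff_of_quartic hT (tau3_pointB hs hε)
      (eq_zero_or_eq_pointB_of_tau3_eq hs hε)
    refine ⟨USet_id, ?_, ?_, USet_neg hT⟩
    · rintro i (rfl | rfl) <;> ext P <;> rw [mem_USet_iff, SetLike.mem_coe, ← hone]
      · rfl
      · have h3 : (tau3 hs hε)^[3] P = -tau3 hs hε P := tau3_tau3 hs hε _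
        rw [h3, sub_neg_eq_add]
        exact torsion_add_iff_of_quartic hT P
    · rw [AddSubgroup.disjoint_def]
      rintro _ ⟨n, rfl⟩ h
      have h2 : 2 • pointB hs = 0 := by rw [two_nsmul]; nth_rw 1 [← hB]; exact neg_add_cancel _
      change (3 : ℤ) • n • pointB hs = 0 at h
      change n • pointB hs = 0
      linear_combination (norm := module) h - n • h2
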